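/- Let $V$ be an infinite set and let $\{B_v\}_{v\in V}$ be pairwise disjoint open disks of radius $\tfrac12$ in $\mathbb R^2$ with centers $c_v$. Let $(V,E)$ be their contact graph, in which $v\sim w$ if and only if the boundary circles of $B_v$ and $B_w$ are tangent, i.e. $|c_v-c_w|=1$, and assume that $(V,E)$ is connected. Embed $(V,E)$ in $\mathbb R^2$ by $v\mapsto c_v$ and by drawing each edge $\{v,w\}$ as the segment $\overline{c_vc_w}$; the faces are the connected components of the complement of the image, and the degree $\deg(\sigma)\in\mathbb N\cup\{\infty\}$ of a face $\sigma$ is the number of its corners, a corner of $\sigma$ at a vertex $v$ being a sector (a connected component of $B_v$ minus the embedded graph) that is contained in $\sigma$. (So corners of angle $\pi$ count, and a vertex may contribute several corners to one face.) Write $B_R(x)=\{y\in V: d(y,x)\le R\}$ for the balls of the combinatorial distance $d$ and $|\cdot|$ for the number of vertices. For every $D\in\mathbb N$ there are constants $C_1,C_2>0$ depending only on $D$ such that for every such infinite connected penny graph $G=(V,E,F)$ with $\deg(\sigma)\le D$ for all faces $\sigma\in F$, all balls are finite and the following hold. (1) Volume doubling: $|B_{2R}(x)|\le C_1|B_R(x)|$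 for all $x\in V$ and all real $R>0$. (2) Poincaré inequality: for all $x\in V$, all real $R>0$ and all $f:B_{2R}(x)\to\mathbb R$, $$\sum_{y\in B_R(x)}|f(y)-\overline f|^2\le C_2R^2\sum_{\substack{y,z\in B_{2R}(x)\\ y\sim z}}|f(y)-f(z)|^2,\qquad \overline f=\frac1{|B_R(x)|}\sum_{y\in B_R(x)}f(y).$$ -/

import Mathlib

/-- The Euclidean plane. -/
abbrev Plane : Type := EuclideanSpace ℝ (Fin 2)

/-- The connected components of a subset `A` of a topological space, as a set of subsets. -/
def componentsOf {X : Type*} [TopologicalSpace X] (A : Set X) : Set (Set X) :=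
  {K | ∃ p ∈ A, K = connectedComponentIn A p}

/-- A configuration of pennies indexed by `V`: pairwise disjoint open disks of radius `1/2` in the
plane, given by their centers. -/
structure PennyConfiguration (V : Type*) where
  center : V → Plane
  disjoint_disks : ∀ v w : V, v ≠ w →
    Disjoint (Metric.ball (center v) (1 / 2)) (Metric.ball (center w) (1 / 2))

namespace PennyConfiguration

variable {V : Type*} (P : PennyConfiguration V)

/-- The open disk of the penny `v`. -/
def disk (v : V) : Set Plane := Metric.ball (P.center v) (1 / 2)

/-- The contact graph: two pennies are adjacent iff their boundary circles (of radius `1/2`, with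
disjoint open disks) are tangent, i.e. iff their centers are at distance `1`. -/
def graph : SimpleGraph V where
  Adj v w := dist (P.center v) (P.center w) = 1
  symm := ⟨fun v w h => by rw [dist_comm]; exact h⟩
  loopless := ⟨fun v h => by simp at h⟩

/-- The image of the geometric embedding of the contact graph: all centers, and for each edge the
segment that joins the two centers. -/
def skeleton : Set Plane :=
  Set.range P.center ∪
    {p | ∃ v w : V, P.graph.Adj v w ∧ p ∈ segment ℝ (P.center v) (P.center w)}

/-- The faces: connected components of the complement of the embedded graph. -/
def faces : Set (Set Plane) := componentsOf P.skeletonᶜ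

/-- The corners (interior angles) of a face `σ`. In the open disk of the penny `v` the embedded
graph consists of the radii along the edges at `v`, which cut the disk into open sectors (a slit
disk, of angle `2π`, if `v` has one neighbour). A corner of `σ` at `v` is such a sector that lies
in `σ`; a vertex that the boundary of `σ` visits several times has several corners in `σ`, and
a corner may have angle `π`. -/
def corners (σ : Set Plane) : Set (V × Set Plane) :=
  {c | c.2 ∈ componentsOf (P.disk c.1 \ P.skeleton) ∧ c.2 ⊆ σ}

/-- The facial degree: the number of corners, in `ℕ ∪ {∞}`. -/
noncomputable def facialDegree (σ : Set Plane) : ℕ∞ := (P.corners σ).encard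

end PennyConfiguration

namespace SimpleGraph

variable {V : Type*} (G : SimpleGraph V)

/-- The ball `B_R(x)` of the combinatorial distance (infinite between different components). -/
def metricBall (x : V) (R : ℝ) : Set V := {y | G.Reachable y x ∧ (G.dist y x : ℝ) ≤ R}

/-- The volume doubling property with constant `C`, for the counting measure. Finiteness of the
balls is part of the property, so that `Set.ncard` is the number of vertices. -/
def VolumeDoublingWith (C : ℝ) : Prop :=
  ∀ (x : V) (R : ℝ), 0 < R →
    (G.metricBall x (2 * R)).Finite ∧
    ((G.metricBall x (2 * R)).ncard : ℝ) ≤ C * ((G.metricBall x R).ncard : ℝ)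

/-- The mean value of `f` over `B_R(x)`. -/
noncomputable def ballMean (x : V) (R : ℝ) (f : V → ℝ) : ℝ :=
  (∑ᶠ y ∈ G.metricBall x R, f y) / ((G.metricBall x R).ncard : ℝ)

/-- The ordered pairs of adjacent vertices in `B_R(x)`. -/
def ballEdges (x : V) (R : ℝ) : Set (V × V) :=
  {p | p.1 ∈ G.metricBall x R ∧ p.2 ∈ G.metricBall x R ∧ G.Adj p.1 p.2}

/-- The (2-)Poincaré inequality with constant `C`. Only the values of `f` on `B_{2R}(x)` matter.
Finiteness of the balls is part of the property, so that all sums are finite sums. -/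
def PoincareWith (C : ℝ) : Prop :=
  ∀ (x : V) (R : ℝ), 0 < R →
    (G.metricBall x (2 * R)).Finite ∧
    ∀ f : V → ℝ,
      ∑ᶠ y ∈ G.metricBall x R, |f y - G.ballMean x R f| ^ 2 ≤
        C * R ^ 2 * ∑ᶠ p ∈ G.ballEdges x (2 * R), |f p.1 - f p.2| ^ 2

end SimpleGraph

/-! ### Packing bounds for separated families of points in the complex plane -/

/-! A penny graph with faces of degree at most `D` is roughly isometric to the square grid, with
constants that depend only on `D`. Volume doubling and the Poincaré inequality are then inherited
from the grid.

Edges have length one, so graph distance dominates Euclidean distance, and unit separation bounds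
the number of vertices in a disk. The reverse comparison comes from the faces. Orbits of `pred` on
oriented edges are boundary walks, and the degree bound leaves at most `D` vertices on each. Winding
numbers replace the Jordan curve theorem in showing that a face has a single boundary walk. For a
finite `pred`-invariant set `O` of darts, the winding number is locally constant off the graph,
jumps by 2π across darts of `O` and vanishes far away. Connectedness of the graph then forces the
value 2π in faces to the left of `O` and 0 in all others (`winding_sectorPt`). Hence vertices of one
face are at graph distance at most `D`, and the face stays near them. A short segment in the plane
therefore yields a chain of vertices with bounded steps inside a bounded region
(`FaceBound.dist_le_of_near`), and `FaceBound.exists_gridApprox` follows.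

The structure `GridApprox` gives quadratic volume growth from above and below. Sampling a function
on the grid gives a Poincaré inequality whose right side lives on a ball enlarged by `6 * L`
(`exists_weak_poincare`). The enlargement is removed in `exists_poincare` by applying it at the
small scale `R / (24 * L)` and chaining local averages. -/

/-- A family of points of the complex plane with mutual distances at least `1`. -/
def UnitSeparated {V : Type*} (c : V → ℂ) : Prop :=
  ∀ v w : V, v ≠ w → 1 ≤ ‖c v - c w‖

namespace UnitSeparated

variable {V : Type*} {c : V → ℂ}

theorem injective (hc : UnitSeparated c) : Function.Injective c := by
  intro v w h
  by_contra hne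
  have := hc v w hne
  rw [h, sub_self, norm_zero] at this
  linarith

/-- The cell of the square grid of mesh `1/2` that contains the point `z`. -/
noncomputable def halfCell (z : ℂ) : ℤ × ℤ := (⌊2 * z.re⌋, ⌊2 * z.im⌋)

/-- A half-open square of side 1/2 has diameter `√2 / 2 < 1`, so it contains at most one point of
the family. Packing bounds reduce to counting cells. -/
theorem halfCell_injective (hc : UnitSeparated c) :
    Function.Injective fun v => halfCell (c v) := by
  intro v w h
  by_contra hne
  have h1 := hc v w hne
  simp only [halfCell, Prod.mk.injEq] at h
  have hr := Int.abs_sub_lt_one_of_floor_eq_floor h.1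
  have hi := Int.abs_sub_lt_one_of_floor_eq_floor h.2
  have h2 : ‖c v - c w‖ ^ 2 = ((c v).re - (c w).re) ^ 2 + ((c v).im - (c w).im) ^ 2 := by
    rw [← Complex.normSq_eq_norm_sq, Complex.normSq_apply]
    simp only [Complex.sub_re, Complex.sub_im]
    ring
  have hr' := abs_lt.1 hr
  have hi' := abs_lt.1 hi
  nlinarith

theorem halfCell_mem_Icc {z w : ℂ} {r : ℝ} (h : ‖w - z‖ ≤ r) :
    halfCell w ∈ Finset.Icc (⌊2 * z.re⌋ - (⌊2 * r⌋ + 1)) (⌊2 * z.re⌋ + (⌊2 * r⌋ + 1)) ×ˢ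
      Finset.Icc (⌊2 * z.im⌋ - (⌊2 * r⌋ + 1)) (⌊2 * z.im⌋ + (⌊2 * r⌋ + 1)) := by
  have key : ∀ x y : ℝ, |x - y| ≤ r → ⌊2 * y⌋ - (⌊2 * r⌋ + 1) ≤ ⌊2 * x⌋ ∧
      ⌊2 * x⌋ ≤ ⌊2 * y⌋ + (⌊2 * r⌋ + 1) := by
    intro x y hxy
    have hxy := abs_le.1 hxy
    have a1 := Int.floor_le (2 * x)
    have a2 := Int.lt_floor_add_one (2 * x)
    have b1 := Int.floor_le (2 * y)
    have b2 := Int.lt_floor_add_one (2 * y)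
    have c2 := Int.lt_floor_add_one (2 * r)
    constructor
    · have : (⌊2 * y⌋ : ℝ) < ⌊2 * x⌋ + (⌊2 * r⌋ + 1) + 1 := by linarith
      have : ⌊2 * y⌋ < ⌊2 * x⌋ + (⌊2 * r⌋ + 1) + 1 := by exact_mod_cast this
      lia
    · have : (⌊2 * x⌋ : ℝ) < ⌊2 * y⌋ + (⌊2 * r⌋ + 1) + 1 := by linarith
      have : ⌊2 * x⌋ < ⌊2 * y⌋ + (⌊2 * r⌋ + 1) + 1 := by exact_mod_cast this
      lia
  have hr := (Complex.abs_re_le_norm (w - z)).trans h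
  have hi := (Complex.abs_im_le_norm (w - z)).trans h
  rw [Complex.sub_re] at hr
  rw [Complex.sub_im] at hi
  simp only [halfCell, Finset.mem_product, Finset.mem_Icc]
  exact ⟨key _ _ hr, key _ _ hi⟩

theorem finite_closedBall (hc : UnitSeparated c) (z : ℂ) (r : ℝ) :
    {v | ‖c v - z‖ ≤ r}.Finite := by
  refine Set.Finite.of_finite_image (f := fun v => halfCell (c v)) ?_
    hc.halfCell_injective.injOn
  refine Set.Finite.subset (Finset.finite_toSet
    (Finset.Icc (⌊2 * z.re⌋ - (⌊2 * r⌋ + 1)) (⌊2 * z.re⌋ + (⌊2 * r⌋ + 1)) ×ˢ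
      Finset.Icc (⌊2 * z.im⌋ - (⌊2 * r⌋ + 1)) (⌊2 * z.im⌋ + (⌊2 * r⌋ + 1)))) ?_
  rintro _ ⟨v, hv, rfl⟩
  exact halfCell_mem_Icc hv

theorem card_le (hc : UnitSeparated c) (z : ℂ) {r : ℝ} (hr : 0 ≤ r) (s : Finset V)
    (hs : ∀ v ∈ s, ‖c v - z‖ ≤ r) : (s.card : ℝ) ≤ (4 * r + 3) ^ 2 := by
  have h0 : 0 ≤ ⌊2 * r⌋ := Int.floor_nonneg.2 (by linarith)
  have h1 : s.card ≤ _ := Finset.card_le_card_of_injOn (fun v => halfCell (c v))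
    (fun v hv => halfCell_mem_Icc (hs v hv)) hc.halfCell_injective.injOn
  rw [Finset.card_product, Int.card_Icc, Int.card_Icc] at h1
  have h2 : ∀ a : ℤ, ((a + (⌊2 * r⌋ + 1) + 1 - (a - (⌊2 * r⌋ + 1))).toNat : ℝ) ≤ 4 * r + 3 := by
    intro a
    have h3 : (((a + (⌊2 * r⌋ + 1) + 1 - (a - (⌊2 * r⌋ + 1))).toNat : ℤ) : ℝ)
        = 2 * ⌊2 * r⌋ + 3 := by
      rw [Int.toNat_of_nonneg (by lia)]
      push_cast
      ring
    rw [Int.cast_natCast] at h3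
    rw [h3]
    linarith [Int.floor_le (2 * r)]
  have h4 : (s.card : ℝ) ≤ _ := Nat.cast_le.2 h1
  rw [Nat.cast_mul] at h4
  refine h4.trans ?_
  rw [sq]
  exact mul_le_mul (h2 _) (h2 _) (Nat.cast_nonneg _) (by linarith)

end UnitSeparated

/-! ### Counterclockwise angles -/

/-- The counterclockwise angle, in `(0, 2π]`, from `1` to `u`. -/
noncomputable def ccwAngle (u : ℂ) : ℝ := toIocMod Real.two_pi_pos 0 (Complex.arg u)

theorem ccwAngle_pos (u : ℂ) : 0 < ccwAngle u := left_lt_toIocMod _ _ _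

theorem ccwAngle_le (u : ℂ) : ccwAngle u ≤ 2 * Real.pi := by
  have h := toIocMod_le_right Real.two_pi_pos 0 (Complex.arg u)
  rw [zero_add] at h
  exact h

theorem exp_ccwAngle {u : ℂ} (hu : ‖u‖ = 1) : Complex.exp (ccwAngle u * Complex.I) = u := by
  have h1 : ccwAngle u = Complex.arg u - toIocDiv Real.two_pi_pos 0 (Complex.arg u) * (2 * Real.pi) :=
    (self_sub_toIocDiv_mul Real.two_pi_pos 0 (Complex.arg u)).symm
  have h2 := Complex.norm_mul_exp_arg_mul_I u
  rw [hu, Complex.ofReal_one, one_mul] at h2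
  rw [h1]
  conv_rhs => rw [← h2]
  rw [Complex.exp_eq_exp_iff_exists_int]
  refine ⟨-toIocDiv Real.two_pi_pos 0 (Complex.arg u), ?_⟩
  push_cast
  ring

theorem ccwAngle_exp {t : ℝ} (h0 : 0 < t) (h1 : t ≤ 2 * Real.pi) :
    ccwAngle (Complex.exp (t * Complex.I)) = t := by
  have h2 : Complex.exp (ccwAngle (Complex.exp (t * Complex.I)) * Complex.I) =
      Complex.exp (t * Complex.I) := exp_ccwAngle (Complex.norm_exp_ofReal_mul_I t)
  rw [Complex.exp_eq_exp_iff_exists_int] at h2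
  obtain ⟨n, hn⟩ := h2
  have h3 : (ccwAngle (Complex.exp (t * Complex.I)) : ℂ) = (t + n * (2 * Real.pi) : ℝ) := by
    have : (ccwAngle (Complex.exp (t * Complex.I)) : ℂ) * Complex.I =
      ((t + n * (2 * Real.pi) : ℝ) : ℂ) * Complex.I := by rw [hn]; push_cast; ring
    exact mul_right_cancel₀ Complex.I_ne_zero this
  have h4 : ccwAngle (Complex.exp (t * Complex.I)) = t + n * (2 * Real.pi) := by exact_mod_cast h3
  have h5 := ccwAngle_pos (Complex.exp (t * Complex.I))
  have h6 := ccwAngle_le (Complex.exp (t * Complex.I))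
  have hp := Real.pi_pos
  have hn1 : n < 1 := by
    have : (n : ℝ) < 1 := by nlinarith
    exact_mod_cast this
  have hn2 : -1 < n := by
    have : (-1 : ℝ) < n := by nlinarith
    exact_mod_cast this
  have : n = 0 := by lia
  rw [h4, this]
  simp

theorem ccwAngle_injOn {u w : ℂ} (hu : ‖u‖ = 1) (hw : ‖w‖ = 1) (h : ccwAngle u = ccwAngle w) :
    u = w := by
  rw [← exp_ccwAngle hu, h, exp_ccwAngle hw]

theorem ccwAngle_div {u w : ℂ} (hu : ‖u‖ = 1) (hw : ‖w‖ = 1) (h : ccwAngle u < ccwAngle w) :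
    ccwAngle (w / u) = ccwAngle w - ccwAngle u := by
  have h1 : w / u = Complex.exp ((ccwAngle w - ccwAngle u : ℝ) * Complex.I) := by
    conv_lhs => rw [← exp_ccwAngle hu, ← exp_ccwAngle hw]
    rw [← Complex.exp_sub]
    congr 1
    push_cast
    ring
  rw [h1, ccwAngle_exp (by linarith)]
  linarith [ccwAngle_le w, ccwAngle_pos u]

/-! ### Penny configurations in the complex plane -/

/-- The Euclidean plane is isometric to the complex plane. -/
noncomputable def planeEquiv : Plane ≃ₗᵢ[ℝ] ℂ := Complex.orthonormalBasisOneI.repr.symm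

namespace PennyConfiguration

variable {V : Type*} (P : PennyConfiguration V)

/-- The center of a penny as a complex number. -/
noncomputable def pos (v : V) : ℂ := planeEquiv (P.center v)

/-- The union of the edges of the contact graph in the complex plane. -/
def net : Set ℂ := {p | ∃ v w : V, P.graph.Adj v w ∧ p ∈ segment ℝ (P.pos v) (P.pos w)}

theorem norm_pos_sub (v w : V) : ‖P.pos v - P.pos w‖ = dist (P.center v) (P.center w) := by
  rw [← dist_eq_norm, pos, pos, planeEquiv.dist_map]

theorem norm_of_adj {v w : V} (h : P.graph.Adj v w) : ‖P.pos w - P.pos v‖ = 1 := by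
  rw [norm_pos_sub, dist_comm]
  exact h

theorem unitSeparated_pos : UnitSeparated P.pos := by
  intro v w hvw
  have h := (disjoint_ball_ball_iff (by norm_num) (by norm_num)).1 (P.disjoint_disks v w hvw)
  rw [norm_pos_sub]
  linarith

theorem finite_neighbors (v : V) : {w | P.graph.Adj v w}.Finite :=
  (P.unitSeparated_pos.finite_closedBall (P.pos v) 1).subset fun _ hw => (P.norm_of_adj hw).le

/-- A point of an edge at distance less than `3/4` from a vertex lies on an edge at this vertex. -/
theorem eq_or_eq_of_mem_segment {a v w : V} {p : ℂ} (h : P.graph.Adj v w)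
    (hp : p ∈ segment ℝ (P.pos v) (P.pos w)) (hpa : ‖p - P.pos a‖ < 3 / 4) : a = v ∨ a = w := by
  by_contra hne
  push Not at hne
  have hv := P.unitSeparated_pos v a (Ne.symm hne.1)
  have hw := P.unitSeparated_pos w a (Ne.symm hne.2)
  have hvw := P.norm_of_adj h
  obtain ⟨s, t, hs, ht, hst, rfl⟩ := hp
  have e : ∀ z : ℂ, ‖z‖ ^ 2 = z.re ^ 2 + z.im ^ 2 := by
    intro z
    rw [← Complex.normSq_eq_norm_sq, Complex.normSq_apply]
    ring
  have h1 : 1 ≤ ‖P.pos v - P.pos a‖ ^ 2 := by nlinarith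
  have h2 : 1 ≤ ‖P.pos w - P.pos a‖ ^ 2 := by nlinarith
  have h3 : ‖P.pos w - P.pos v‖ ^ 2 = 1 := by rw [hvw]; norm_num
  have h4 : ‖s • P.pos v + t • P.pos w - P.pos a‖ ^ 2 < 9 / 16 := by
    nlinarith [norm_nonneg (s • P.pos v + t • P.pos w - P.pos a)]
  -- Stewart's theorem. For a third centre `a` the right side is at least `1 - s * t ≥ 3 / 4`, which
  -- exceeds `9 / 16`.
  have h5 : ‖s • P.pos v + t • P.pos w - P.pos a‖ ^ 2 = s * ‖P.pos v - P.pos a‖ ^ 2 +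
      t * ‖P.pos w - P.pos a‖ ^ 2 - s * t * ‖P.pos w - P.pos v‖ ^ 2 := by
    obtain rfl : s = 1 - t := by linarith
    simp only [e, Complex.sub_re, Complex.sub_im, Complex.add_re, Complex.add_im, Complex.smul_re,
      Complex.smul_im, smul_eq_mul]
    ring
  rw [h5, h3] at h4
  obtain rfl : s = 1 - t := by linarith
  nlinarith [sq_nonneg (t - 1 / 2)]

/-- The points of the net near the vertex `a` lie on the segments that issue from `a`. -/
theorem exists_adj_of_mem_net {a : V} {p : ℂ} (hp : p ∈ P.net) (hpa : ‖p - P.pos a‖ < 3 / 4) :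
    ∃ b, P.graph.Adj a b ∧ p = P.pos a + ‖p - P.pos a‖ * (P.pos b - P.pos a) := by
  obtain ⟨v, w, h, hp⟩ := hp
  have aux : ∀ b, P.graph.Adj a b → p ∈ segment ℝ (P.pos a) (P.pos b) →
      p = P.pos a + ‖p - P.pos a‖ * (P.pos b - P.pos a) := by
    intro b hb hpb
    rw [segment_eq_image'] at hpb
    obtain ⟨t, ht, rfl⟩ := hpb
    simp only [add_sub_cancel_left, norm_smul, P.norm_of_adj hb, mul_one, Real.norm_eq_abs,
      abs_of_nonneg ht.1]
    rw [Complex.real_smul]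
  rcases P.eq_or_eq_of_mem_segment h hp hpa with rfl | rfl
  · exact ⟨w, h, aux w h hp⟩
  · exact ⟨v, h.symm, aux v h.symm (by rwa [segment_symm])⟩

theorem mem_net_of_adj {a b : V} (h : P.graph.Adj a b) {ρ : ℝ} (h0 : 0 ≤ ρ) (h1 : ρ ≤ 1) :
    P.pos a + ρ * (P.pos b - P.pos a) ∈ P.net := by
  refine ⟨a, b, h, ?_⟩
  rw [segment_eq_image']
  exact ⟨ρ, ⟨h0, h1⟩, by simp⟩

/-- The edges form a locally finite family: an edge that meets the unit disk around `z` has both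
ends within 2 of `z`, and only finitely many centres lie there. -/
theorem isClosed_net : IsClosed P.net := by
  have h : P.net = ⋃ d : P.graph.Dart, segment ℝ (P.pos d.fst) (P.pos d.snd) := by
    ext p
    simp only [Set.mem_iUnion]
    exact ⟨fun ⟨v, w, hvw, hp⟩ => ⟨⟨(v, w), hvw⟩, hp⟩, fun ⟨d, hd⟩ => ⟨d.fst, d.snd, d.adj, hd⟩⟩
  rw [h]
  refine LocallyFinite.isClosed_iUnion ?_ fun d => ?_
  · intro z
    refine ⟨Metric.ball z 1, Metric.ball_mem_nhds z one_pos, ?_⟩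
    have hf := P.unitSeparated_pos.finite_closedBall z 2
    refine Set.Finite.of_finite_image (f := fun d => d.toProd) ((hf.prod hf).subset ?_)
      (fun d _ e _ hde => SimpleGraph.Dart.ext _ _ hde)
    rintro _ ⟨d, ⟨p, hp, hpz⟩, rfl⟩
    simp only [segment_eq_image'] at hp
    obtain ⟨t, ht, rfl⟩ := hp
    have hd := P.norm_of_adj d.adj
    rw [mem_ball_iff_norm] at hpz
    have e1 : P.pos d.fst - z = (P.pos d.fst + t • (P.pos d.snd - P.pos d.fst) - z) -
        t • (P.pos d.snd - P.pos d.fst) := by ring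
    have e2 : P.pos d.snd - z = (P.pos d.fst + t • (P.pos d.snd - P.pos d.fst) - z) +
        (1 - t) • (P.pos d.snd - P.pos d.fst) := by
      simp only [Complex.real_smul]; push_cast; ring
    constructor
    · change ‖P.pos d.fst - z‖ ≤ 2
      rw [e1]
      refine (norm_sub_le _ _).trans ?_
      rw [norm_smul, hd, mul_one, Real.norm_of_nonneg ht.1]
      linarith [ht.2]
    · change ‖P.pos d.snd - z‖ ≤ 2
      rw [e2]
      refine (norm_add_le _ _).trans ?_
      rw [norm_smul, hd, mul_one, Real.norm_of_nonneg (by linarith [ht.2])]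
      linarith [ht.1]
  · rw [segment_eq_image']
    exact (isCompact_Icc.image (by fun_prop)).isClosed

/-! ### The rotation system -/

/-- The direction of a dart. -/
noncomputable def dir (d : P.graph.Dart) : ℂ := P.pos d.snd - P.pos d.fst

theorem norm_dir (d : P.graph.Dart) : ‖P.dir d‖ = 1 := P.norm_of_adj d.adj

theorem dir_ne_zero (d : P.graph.Dart) : P.dir d ≠ 0 := by
  rw [← norm_pos_iff, norm_dir]; exact one_pos

theorem norm_dir_div (d e : P.graph.Dart) : ‖P.dir d / P.dir e‖ = 1 := by
  rw [norm_div, norm_dir, norm_dir, div_one]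

theorem dart_ext {d e : P.graph.Dart} (h : d.fst = e.fst) (h' : P.dir d = P.dir e) : d = e := by
  refine SimpleGraph.Dart.ext _ _ (Prod.ext h (P.unitSeparated_pos.injective ?_))
  simp only [dir, h] at h'
  exact sub_left_inj.1 h'

theorem finite_darts (v : V) : {d : P.graph.Dart | d.fst = v}.Finite := by
  refine Set.Finite.of_finite_image (f := fun d => d.snd) ((P.finite_neighbors v).subset ?_) ?_
  · rintro _ ⟨d, rfl, rfl⟩
    exact d.adj
  · rintro d rfl e he hde
    exact SimpleGraph.Dart.ext _ _ (Prod.ext he.symm hde)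

/-- The range `(0, 2π]` of `ccwAngle` places `d` at angle 2π from itself. It is thus the last
candidate, chosen only at a vertex of degree one, where the gap is the full slit disk. -/
theorem exists_next (d : P.graph.Dart) : ∃ n : P.graph.Dart, n.fst = d.fst ∧
    ∀ e : P.graph.Dart, e.fst = d.fst →
      ccwAngle (P.dir n / P.dir d) ≤ ccwAngle (P.dir e / P.dir d) := by
  obtain ⟨n, hn, hmin⟩ := Set.exists_min_image _ (fun e => ccwAngle (P.dir e / P.dir d))
    (P.finite_darts d.fst) ⟨d, rfl⟩
  exact ⟨n, hn, hmin⟩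

/-- The next dart at the same vertex, counterclockwise. -/
noncomputable def next (d : P.graph.Dart) : P.graph.Dart := (P.exists_next d).choose

theorem next_fst (d : P.graph.Dart) : (P.next d).fst = d.fst := (P.exists_next d).choose_spec.1

/-- The angle from a dart to the next one. -/
noncomputable def gap (d : P.graph.Dart) : ℝ := ccwAngle (P.dir (P.next d) / P.dir d)

theorem gap_le {d e : P.graph.Dart} (h : e.fst = d.fst) :
    P.gap d ≤ ccwAngle (P.dir e / P.dir d) := (P.exists_next d).choose_spec.2 e h

theorem gap_pos (d : P.graph.Dart) : 0 < P.gap d := ccwAngle_pos _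

theorem gap_le_two_pi (d : P.graph.Dart) : P.gap d ≤ 2 * Real.pi := ccwAngle_le _

theorem dir_next (d : P.graph.Dart) :
    P.dir (P.next d) = Complex.exp (P.gap d * Complex.I) * P.dir d := by
  rw [gap, exp_ccwAngle (P.norm_dir_div _ _), div_mul_cancel₀ _ (P.dir_ne_zero d)]

theorem ccwAngle_dir_div_next {d : P.graph.Dart} {u : ℂ} (hu : ‖u‖ = 1)
    (h : P.gap d < ccwAngle (u / P.dir d)) :
    ccwAngle (u / P.dir (P.next d)) = ccwAngle (u / P.dir d) - P.gap d := by
  have h1 : ‖u / P.dir d‖ = 1 := by rw [norm_div, hu, norm_dir, div_one]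
  have h2 := ccwAngle_div (P.norm_dir_div (P.next d) d) h1 h
  rwa [div_div_div_cancel_right₀ (P.dir_ne_zero d)] at h2

/-- If two darts had the same successor and different gaps, the one with the smaller gap would lie
strictly between the other and its successor. -/
theorem next_injective : Function.Injective P.next := by
  have key : ∀ d e : P.graph.Dart, P.next d = P.next e → ¬ P.gap d < P.gap e := by
    intro d e h hlt
    have hfst : d.fst = e.fst := by rw [← P.next_fst d, h, P.next_fst e]
    have h1 := ccwAngle_div (P.norm_dir_div (P.next d) d) (P.norm_dir_div (P.next e) e) hlt
    have h2 : P.dir (P.next e) / P.dir e / (P.dir (P.next d) / P.dir d) = P.dir d / P.dir e := by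
      rw [h]
      field_simp [P.dir_ne_zero]
    rw [h2] at h1
    have h3 := P.gap_le hfst
    have h4 := P.gap_pos d
    unfold gap at h3 h4
    linarith
  intro d e h
  have hfst : d.fst = e.fst := by rw [← P.next_fst d, h, P.next_fst e]
  have hgap : P.gap d = P.gap e := le_antisymm (not_lt.1 (key e d h.symm)) (not_lt.1 (key d e h))
  refine P.dart_ext hfst ?_
  have h1 := P.dir_next d
  rw [h, P.dir_next e, hgap] at h1
  exact (mul_left_cancel₀ (Complex.exp_ne_zero _) h1).symm

/-- The darts at a vertex form a single cycle under `next`. -/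
theorem eq_of_next_invariant {α : Type*} (g : P.graph.Dart → α) (hg : ∀ d, g (P.next d) = g d)
    {d e : P.graph.Dart} (h : d.fst = e.fst) : g d = g e := by
  -- Among the darts with the value `g d`, `m` is the last one before `e`. Its successor has the
  -- same value and would come closer to `e`, unless it is `e` itself.
  obtain ⟨m, ⟨hm1, hm2⟩, hmin⟩ := Set.exists_min_image {x : P.graph.Dart | x.fst = d.fst ∧ g x = g d}
    (fun x => ccwAngle (P.dir e / P.dir x)) ((P.finite_darts d.fst).subset fun x hx => hx.1)
    ⟨d, rfl, rfl⟩
  have hle : P.gap m ≤ ccwAngle (P.dir e / P.dir m) := P.gap_le (by rw [hm1, h])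
  rcases hle.eq_or_lt with heq | hlt
  · have h1 := ccwAngle_injOn (P.norm_dir_div _ _) (P.norm_dir_div _ _) heq
    have h2 : P.dir (P.next m) = P.dir e := by
      rwa [div_left_inj' (P.dir_ne_zero m)] at h1
    have h3 : P.next m = e := P.dart_ext (by rw [P.next_fst, hm1, h]) h2
    rw [← hm2, ← h3, hg]
  · have h1 := hmin (P.next m) ⟨by rw [P.next_fst, hm1], by rw [hg, hm2]⟩
    rw [P.ccwAngle_dir_div_next (P.norm_dir e) hlt] at h1
    linarith [P.gap_pos m]

/-- The predecessor of a dart on the boundary walk of the face on its left. -/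
noncomputable def pred (d : P.graph.Dart) : P.graph.Dart := (P.next d).symm

theorem pred_snd (d : P.graph.Dart) : (P.pred d).snd = d.fst := P.next_fst d

theorem pred_injective : Function.Injective P.pred :=
  SimpleGraph.Dart.symm_involutive.injective.comp P.next_injective

end PennyConfiguration

namespace PennyConfiguration

variable {V : Type*} (P : PennyConfiguration V)

/-! ### Sectors and faces -/

/-- The point at distance `ρ` from the initial vertex of `d`, at the angle `t` from `d`. -/
noncomputable def polarPt (d : P.graph.Dart) (ρ t : ℝ) : ℂ :=
  P.pos d.fst + ρ * Complex.exp (t * Complex.I) * P.dir d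

/-- The open sector of radius `3/4` between a dart and the next one. -/
noncomputable def sector (d : P.graph.Dart) : Set ℂ :=
  (fun x : ℝ × ℝ => P.polarPt d x.1 x.2) '' (Set.Ioo 0 (3 / 4) ×ˢ Set.Ioo 0 (P.gap d))

/-- A point in the sector of a dart. -/
noncomputable def sectorPt (d : P.graph.Dart) : ℂ := P.polarPt d (1 / 4) (P.gap d / 2)

/-- The face on the left of a dart. -/
noncomputable def faceOf (d : P.graph.Dart) : Set ℂ := connectedComponentIn P.netᶜ (P.sectorPt d)

theorem norm_polarPt_sub (d : P.graph.Dart) {ρ : ℝ} (hρ : 0 ≤ ρ) (t : ℝ) :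
    ‖P.polarPt d ρ t - P.pos d.fst‖ = ρ := by
  rw [polarPt, add_sub_cancel_left, norm_mul, norm_mul, norm_dir, Complex.norm_exp_ofReal_mul_I,
    Complex.norm_real, Real.norm_of_nonneg hρ, mul_one, mul_one]

theorem sectorPt_mem_sector (d : P.graph.Dart) : P.sectorPt d ∈ P.sector d :=
  ⟨(1 / 4, P.gap d / 2), ⟨⟨by norm_num, by norm_num⟩, by linarith [P.gap_pos d],
    by linarith [P.gap_pos d]⟩, rfl⟩

theorem sector_subset (d : P.graph.Dart) : P.sector d ⊆ P.netᶜ := by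
  rintro _ ⟨⟨ρ, t⟩, ⟨⟨h0, h1⟩, ht0, ht1⟩, rfl⟩ hnet
  simp only at h0 h1 ht0 ht1
  have hn := P.norm_polarPt_sub d h0.le t
  obtain ⟨b, hb, hpb⟩ := P.exists_adj_of_mem_net (a := d.fst) hnet (by rw [hn]; exact h1)
  simp only [hn] at hpb
  let e : P.graph.Dart := ⟨(d.fst, b), hb⟩
  have h2 : Complex.exp (t * Complex.I) * P.dir d = P.dir e := by
    have h3 : (ρ : ℂ) ≠ 0 := by exact_mod_cast h0.ne'
    refine mul_left_cancel₀ h3 ?_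
    rw [polarPt, mul_assoc] at hpb
    exact add_left_cancel hpb
  have h3 : P.dir e / P.dir d = Complex.exp (t * Complex.I) := by
    rw [← h2, mul_div_cancel_right₀ _ (P.dir_ne_zero d)]
  have h4 := P.gap_le (d := d) (e := e) rfl
  rw [h3, ccwAngle_exp ht0 (ht1.le.trans (P.gap_le_two_pi d))] at h4
  linarith

theorem isPreconnected_sector (d : P.graph.Dart) : IsPreconnected (P.sector d) := by
  refine (isPreconnected_Ioo.prod isPreconnected_Ioo).image _ ?_
  unfold polarPt
  fun_prop

theorem sector_subset_faceOf (d : P.graph.Dart) : P.sector d ⊆ P.faceOf d :=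
  (P.isPreconnected_sector d).subset_connectedComponentIn (P.sectorPt_mem_sector d)
    (P.sector_subset d)

theorem sectorPt_not_mem_net (d : P.graph.Dart) : P.sectorPt d ∉ P.net :=
  P.sector_subset d (P.sectorPt_mem_sector d)

theorem sectorPt_mem_faceOf (d : P.graph.Dart) : P.sectorPt d ∈ P.faceOf d :=
  P.sector_subset_faceOf d (P.sectorPt_mem_sector d)

theorem faceOf_eq_of_mem {d : P.graph.Dart} {p : ℂ} (h : p ∈ P.faceOf d) :
    P.faceOf d = connectedComponentIn P.netᶜ p := connectedComponentIn_eq h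

theorem faceOf_eq_of_mem_of_mem {d e : P.graph.Dart} {p : ℂ} (h : p ∈ P.faceOf d)
    (he : p ∈ P.faceOf e) : P.faceOf d = P.faceOf e := by
  rw [P.faceOf_eq_of_mem h, P.faceOf_eq_of_mem he]

/-- The point at height `τ` above the midpoint of a dart. -/
noncomputable def sidePt (d : P.graph.Dart) (τ : ℝ) : ℂ :=
  P.pos d.fst + (1 / 2 + τ * Complex.I) * P.dir d

theorem dir_symm (d : P.graph.Dart) : P.dir d.symm = -P.dir d := by
  simp [dir]

theorem sidePt_symm (d : P.graph.Dart) (τ : ℝ) : P.sidePt d.symm τ = P.sidePt d (-τ) := by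
  simp only [sidePt, dir_symm]
  have : P.pos d.symm.fst = P.pos d.fst + P.dir d := by simp [dir]
  rw [this]
  push_cast
  ring

/-- Sectors have radius 3/4 > 1/2 in order to reach past the midpoints of edges. Points close to the
midpoint, on either side, have polar radius below 3/4 and a small angle. -/
theorem eventually_polar {g : ℝ} (hg : 0 < g) : ∀ᶠ τ : ℝ in nhdsWithin 0 (Set.Ioi 0),
    ∃ ρ ∈ Set.Ioo (0 : ℝ) (3 / 4), ∃ t ∈ Set.Ioo 0 g,
      (1 / 2 + τ * Complex.I : ℂ) = ρ * Complex.exp (t * Complex.I) ∧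
      (1 / 2 - τ * Complex.I : ℂ) = ρ * Complex.exp (-(t * Complex.I)) := by
  have hc : ContinuousAt (fun τ : ℝ => (1 / 2 + τ * Complex.I : ℂ)) 0 := by fun_prop
  have h1 : ∀ᶠ τ : ℝ in nhds 0, ‖(1 / 2 + τ * Complex.I : ℂ)‖ < 3 / 4 := by
    refine hc.norm.eventually_lt_const ?_
    norm_num
  have h2 : ∀ᶠ τ : ℝ in nhds 0, Complex.arg (1 / 2 + τ * Complex.I : ℂ) < g := by
    have hs : (1 / 2 + ((0 : ℝ) : ℂ) * Complex.I : ℂ) ∈ Complex.slitPlane := by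
      left; norm_num
    have h0 : Complex.arg (1 / 2 + ((0 : ℝ) : ℂ) * Complex.I) = 0 := by
      rw [Complex.arg_eq_zero_iff]; norm_num
    have h := (Complex.continuousAt_arg hs).tendsto.comp hc
    rw [h0] at h
    exact h.eventually_lt_const hg
  filter_upwards [nhdsWithin_le_nhds h1, nhdsWithin_le_nhds h2, self_mem_nhdsWithin] with τ h1 h2 h3
  have h3 : 0 < τ := h3
  set z : ℂ := 1 / 2 + τ * Complex.I with hz
  have him : z.im = τ := by simp [hz]
  have hne : z ≠ 0 := by
    intro h; rw [h] at him; simp at him; linarith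
  have harg : 0 < Complex.arg z := by
    refine lt_of_le_of_ne (Complex.arg_nonneg_iff.2 (him ▸ h3.le)) fun h => ?_
    have := (Complex.arg_eq_zero_iff.1 h.symm).2
    linarith
  refine ⟨‖z‖, ⟨norm_pos_iff.2 hne, h1⟩, Complex.arg z, ⟨harg, h2⟩,
    (Complex.norm_mul_exp_arg_mul_I z).symm, ?_⟩
  have h4 := congrArg (starRingEnd ℂ) (Complex.norm_mul_exp_arg_mul_I z)
  rw [map_mul, ← Complex.exp_conj, map_mul, Complex.conj_I, Complex.conj_ofReal,
    Complex.conj_ofReal, mul_neg] at h4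
  rw [h4]
  apply Complex.ext <;> simp [hz]

theorem eventually_sidePt_mem_sector (d : P.graph.Dart) :
    ∀ᶠ τ : ℝ in nhdsWithin 0 (Set.Ioi 0), P.sidePt d τ ∈ P.sector d := by
  filter_upwards [eventually_polar (P.gap_pos d)] with τ ⟨ρ, hρ, t, ht, h1, _⟩
  refine ⟨(ρ, t), ⟨hρ, ht⟩, ?_⟩
  simp only [polarPt, sidePt, h1]

theorem eventually_sidePt_pred_mem_sector (d : P.graph.Dart) :
    ∀ᶠ τ : ℝ in nhdsWithin 0 (Set.Ioi 0), P.sidePt (P.pred d) τ ∈ P.sector d := by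
  filter_upwards [eventually_polar (P.gap_pos d)] with τ ⟨ρ, hρ, t, ht, _, h1⟩
  refine ⟨(ρ, P.gap d - t), ⟨hρ, by linarith [ht.2], by linarith [ht.1]⟩, ?_⟩
  have h2 : (1 / 2 + ((-τ : ℝ) : ℂ) * Complex.I : ℂ) = 1 / 2 - τ * Complex.I := by
    push_cast; ring
  rw [pred, sidePt_symm, sidePt, P.next_fst, h2, h1, P.dir_next]
  simp only [polarPt]
  have h3 : Complex.exp (((P.gap d - t : ℝ) : ℂ) * Complex.I) =
      Complex.exp (-(t * Complex.I)) * Complex.exp (P.gap d * Complex.I) := by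
    rw [← Complex.exp_add]; congr 1; push_cast; ring
  rw [h3]
  ring

/-- The sectors of `d` and of `pred d` lie on the same side of their common edge and overlap near
its midpoint. -/
theorem faceOf_pred (d : P.graph.Dart) : P.faceOf (P.pred d) = P.faceOf d := by
  obtain ⟨τ, h1, h2⟩ := ((P.eventually_sidePt_mem_sector (P.pred d)).and
    (P.eventually_sidePt_pred_mem_sector d)).exists
  exact P.faceOf_eq_of_mem_of_mem (P.sector_subset_faceOf _ h1) (P.sector_subset_faceOf _ h2)

/-- The sectors at a vertex cover a punctured neighbourhood outside the net. -/
theorem exists_mem_sector {a : V} (ha : ∃ b, P.graph.Adj a b) {q : ℂ} (hq : q ∉ P.net)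
    (hqa : ‖q - P.pos a‖ < 3 / 4) : ∃ d : P.graph.Dart, d.fst = a ∧ q ∈ P.sector d := by
  obtain ⟨b, hb⟩ := ha
  have hne : q ≠ P.pos a := by
    rintro rfl
    have := P.mem_net_of_adj hb le_rfl zero_le_one
    simp at this
    exact hq this
  have hρ : 0 < ‖q - P.pos a‖ := norm_pos_iff.2 (sub_ne_zero.2 hne)
  set ρ := ‖q - P.pos a‖ with hρdef
  have hρc : (ρ : ℂ) ≠ 0 := by exact_mod_cast hρ.ne'
  set u : ℂ := (q - P.pos a) / ρ with hu
  have hq' : q = P.pos a + ρ * u := by rw [hu]; field_simp; ring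
  have hun : ‖u‖ = 1 := by
    rw [hu, norm_div, Complex.norm_real, Real.norm_of_nonneg hρ.le, ← hρdef, div_self hρ.ne']
  obtain ⟨m, hm, hmin⟩ := Set.exists_min_image _ (fun e => ccwAngle (u / P.dir e))
    (P.finite_darts a) ⟨⟨(a, b), hb⟩, rfl⟩
  have hm : m.fst = a := hm
  have hum : ‖u / P.dir m‖ = 1 := by rw [norm_div, hun, norm_dir, div_one]
  refine ⟨m, hm, (ρ, ccwAngle (u / P.dir m)), ⟨⟨hρ, hqa⟩, ccwAngle_pos _, ?_⟩, ?_⟩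
  · by_contra hle
    simp only [not_lt] at hle
    rcases hle.eq_or_lt with heq | hlt
    · have h1 := ccwAngle_injOn (P.norm_dir_div _ _) hum heq
      rw [div_left_inj' (P.dir_ne_zero m)] at h1
      refine hq ?_
      have h2 := P.mem_net_of_adj (P.next m).adj hρ.le (by linarith)
      rw [P.next_fst, hm] at h2
      rw [hq', ← h1]
      simpa [dir, P.next_fst, hm] using h2
    · have h1 := hmin (P.next m) (by rw [Set.mem_ofPred_eq, P.next_fst, hm])
      rw [P.ccwAngle_dir_div_next hun hlt] at h1
      linarith [P.gap_pos m]
  · simp only [polarPt]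
    rw [exp_ccwAngle hum, mul_assoc, div_mul_cancel₀ _ (P.dir_ne_zero m), hm, ← hq']

end PennyConfiguration

theorem IsPreconnected.eq_of_continuousOn_int {X : Type*} [TopologicalSpace X] {s : Set X}
    (hs : IsPreconnected s) {f : X → ℝ} (hf : ContinuousOn f s) {T : ℝ} (hT : 0 < T)
    (hint : ∀ x ∈ s, ∃ n : ℤ, f x = n * T) {x y : X} (hx : x ∈ s) (hy : y ∈ s) : f x = f y := by
  have key : ∀ a ∈ s, ∀ b ∈ s, ¬ f a < f b := by
    intro a ha b hb hlt
    obtain ⟨m, hm⟩ := hint a ha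
    obtain ⟨n, hn⟩ := hint b hb
    have hmn : m < n := by
      have : (m : ℝ) < n := by
        rw [hm, hn] at hlt
        exact lt_of_mul_lt_mul_right hlt hT.le
      exact_mod_cast this
    have hmn' : (m : ℝ) + 1 ≤ n := by exact_mod_cast hmn
    -- Two different values would force the intermediate value `(m + 1/2) * T`, which is not an
    -- integer multiple of `T`.
    obtain ⟨z, hz, hfz⟩ := hs.intermediate_value ha hb hf
      (show m * T + T / 2 ∈ Set.Icc (f a) (f b) from ⟨by linarith, by nlinarith⟩)
    obtain ⟨k, hk⟩ := hint z hz
    have h1 : (k : ℝ) = m + 1 / 2 := by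
      refine mul_right_cancel₀ hT.ne' ?_
      rw [← hk, hfz]; ring
    have h2 : (2 * k : ℝ) = 2 * m + 1 := by linarith
    have h3 : 2 * k = 2 * m + 1 := by exact_mod_cast h2
    lia
  exact le_antisymm (not_lt.1 (key y hy x hx)) (not_lt.1 (key x hx y hy))

namespace PennyConfiguration

open Filter Topology

variable {V : Type*} (P : PennyConfiguration V)

/-! ### Winding numbers of families of darts -/

/-- The angle under which a dart is seen from `p`. -/
noncomputable def viewAngle (d : P.graph.Dart) (p : ℂ) : ℝ :=
  Complex.arg ((P.pos d.snd - p) / (P.pos d.fst - p))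

/-- The total angle under which a finite family of darts is seen from `p`. -/
noncomputable def winding (O : Finset P.graph.Dart) (p : ℂ) : ℝ := ∑ d ∈ O, P.viewAngle d p

theorem continuousAt_viewAngle {d : P.graph.Dart} {p : ℂ}
    (hp : p ∉ segment ℝ (P.pos d.fst) (P.pos d.snd)) : ContinuousAt (P.viewAngle d) p := by
  have h1 : P.pos d.fst - p ≠ 0 := by
    intro h
    rw [sub_eq_zero] at h
    exact hp (h ▸ left_mem_segment _ _ _)
  have hs : (P.pos d.snd - p) / (P.pos d.fst - p) ∈ Complex.slitPlane := by
    rw [Complex.mem_slitPlane_iff]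
    by_contra hcon
    push Not at hcon
    obtain ⟨hre, him⟩ := hcon
    set z := (P.pos d.snd - p) / (P.pos d.fst - p) with hz
    have h2 : z = ((z.re : ℝ) : ℂ) := Complex.ext (by simp) (by simp [him])
    have h3 : P.pos d.snd - p = z.re * (P.pos d.fst - p) := by
      rw [← h2, hz, div_mul_cancel₀ _ h1]
    have h4 : (1 - z.re : ℂ) ≠ 0 := by
      have : (1 - z.re : ℝ) ≠ 0 := by linarith
      exact_mod_cast this
    -- The quotient is a real number `z.re ≤ 0`. Solving `h3` for `p` exhibits it as a convex
    -- combination of the two ends.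
    refine hp ⟨-z.re / (1 - z.re), 1 / (1 - z.re), div_nonneg (by linarith) (by linarith),
      div_nonneg (by linarith) (by linarith), ?_, ?_⟩
    · have : (1 - z.re : ℝ) ≠ 0 := by linarith
      field_simp
      ring
    · simp only [Complex.real_smul]
      push_cast
      field_simp
      linear_combination h3
  refine ContinuousAt.comp (f := fun q => (P.pos d.snd - q) / (P.pos d.fst - q))
    (Complex.continuousAt_arg hs) ?_
  exact ContinuousAt.div (by fun_prop) (by fun_prop) h1

theorem continuousOn_winding (O : Finset P.graph.Dart) : ContinuousOn (P.winding O) P.netᶜ := by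
  unfold winding
  refine continuousOn_finsetSum _ fun d _ p hp => ?_
  exact (P.continuousAt_viewAngle fun h => hp ⟨_, _, d.adj, h⟩).continuousWithinAt

theorem pos_ne_of_not_mem_net {p : ℂ} (hp : p ∉ P.net) (d : P.graph.Dart) :
    P.pos d.fst - p ≠ 0 := by
  intro h
  rw [sub_eq_zero] at h
  exact hp ⟨_, _, d.adj, h ▸ left_mem_segment _ _ _⟩

theorem exp_viewAngle {p : ℂ} (hp : p ∉ P.net) (d : P.graph.Dart) :
    Complex.exp (P.viewAngle d p * Complex.I) =
      ((P.pos d.snd - p) / ‖P.pos d.snd - p‖) / ((P.pos d.fst - p) / ‖P.pos d.fst - p‖) := by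
  have h1 := P.pos_ne_of_not_mem_net hp d
  have h2 := P.pos_ne_of_not_mem_net hp d.symm
  have h2 : P.pos d.snd - p ≠ 0 := h2
  have h3 := Complex.norm_mul_exp_arg_mul_I ((P.pos d.snd - p) / (P.pos d.fst - p))
  have e1 : ((‖P.pos d.fst - p‖ : ℝ) : ℂ) ≠ 0 := by exact_mod_cast (norm_pos_iff.2 h1).ne'
  have e2 : ((‖P.pos d.snd - p‖ : ℝ) : ℂ) ≠ 0 := by exact_mod_cast (norm_pos_iff.2 h2).ne'
  rw [norm_div, Complex.ofReal_div] at h3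
  rw [viewAngle]
  have e3 : ((‖P.pos d.snd - p‖ : ℝ) : ℂ) / ((‖P.pos d.fst - p‖ : ℝ) : ℂ) ≠ 0 := div_ne_zero e2 e1
  refine mul_left_cancel₀ e3 ?_
  rw [h3]
  field_simp

-- The exponential of the total angle is a quotient of two products of unit vectors, one over
-- terminal and one over initial vertices. They agree because `pred` permutes `O` and the end of
-- `pred d` is the start of `d`.
open Classical in
theorem winding_eq_int {O : Finset P.graph.Dart} (hO : O.image P.pred = O) {p : ℂ}
    (hp : p ∉ P.net) : ∃ n : ℤ, P.winding O p = n * (2 * Real.pi) := by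
  have h1 : Complex.exp (P.winding O p * Complex.I) = 1 := by
    rw [winding, Complex.ofReal_sum, Finset.sum_mul, Complex.exp_sum]
    rw [Finset.prod_congr rfl fun d _ => P.exp_viewAngle hp d, Finset.prod_div_distrib]
    have h2 : ∏ d ∈ O, ((P.pos d.snd - p) / ‖P.pos d.snd - p‖) =
        ∏ d ∈ O, ((P.pos d.fst - p) / ‖P.pos d.fst - p‖) := by
      conv_lhs => rw [← hO]
      rw [Finset.prod_image P.pred_injective.injOn]
      simp only [P.pred_snd]
    rw [h2]
    refine div_self (Finset.prod_ne_zero_iff.2 fun d _ => ?_)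
    have h3 := P.pos_ne_of_not_mem_net hp d
    exact div_ne_zero h3 (by exact_mod_cast (norm_pos_iff.2 h3).ne')
  obtain ⟨n, hn⟩ := Complex.exp_eq_one_iff.1 h1
  refine ⟨n, ?_⟩
  have h2 : ((P.winding O p : ℝ) : ℂ) = ((n * (2 * Real.pi) : ℝ) : ℂ) := by
    refine mul_right_cancel₀ Complex.I_ne_zero ?_
    rw [hn]; push_cast; ring
  exact_mod_cast h2

open Classical in
theorem winding_eq_of_mem_faceOf {O : Finset P.graph.Dart} (hO : O.image P.pred = O)
    {d : P.graph.Dart} {p : ℂ} (hp : p ∈ P.faceOf d) :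
    P.winding O p = P.winding O (P.sectorPt d) := by
  have hsub : P.faceOf d ⊆ P.netᶜ := connectedComponentIn_subset _ _
  refine isPreconnected_connectedComponentIn.eq_of_continuousOn_int
    ((P.continuousOn_winding O).mono hsub) Real.two_pi_pos
    (fun x hx => P.winding_eq_int hO (hsub hx)) hp (P.sectorPt_mem_faceOf d)

/-! ### The jump of the winding number across an edge -/

theorem im_cross_pos {τ : ℝ} (hτ : 0 < τ) :
    0 < (-(1 / 2 - τ * Complex.I) / (1 / 2 + τ * Complex.I)).im := by
  have h2 : (1 / 2 + τ * Complex.I : ℂ) ≠ 0 := by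
    intro h; have := congrArg Complex.im h; simp at this; linarith
  have hn := Complex.normSq_pos.2 h2
  have h3 : (-(1 / 2 - τ * Complex.I) / (1 / 2 + τ * Complex.I)).im =
      τ / Complex.normSq (1 / 2 + τ * Complex.I) := by
    rw [Complex.div_im, ← sub_div]
    congr 1
    simp
    ring
  rw [h3]
  exact div_pos hτ hn

/-- As a point tends to the midpoint of a dart from the left, it sees the dart under an angle
tending to π. From the right the limit is -π by `arg_cross_neg`, whence a jump of 2π. -/
theorem tendsto_arg_cross : Tendsto (fun τ : ℝ => Complex.arg
    (-(1 / 2 - τ * Complex.I) / (1 / 2 + τ * Complex.I))) (𝓝[>] 0) (𝓝 Real.pi) := by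
  have hc : ContinuousAt (fun τ : ℝ => (-(1 / 2 - τ * Complex.I) / (1 / 2 + τ * Complex.I) : ℂ)) 0 :=
    ContinuousAt.div (by fun_prop) (by fun_prop) (by norm_num)
  have h0 : Tendsto (fun τ : ℝ => (-(1 / 2 - τ * Complex.I) / (1 / 2 + τ * Complex.I) : ℂ)) (𝓝[>] 0)
      (𝓝[{z | 0 ≤ z.im}] (-1)) := by
    refine tendsto_nhdsWithin_iff.2 ⟨?_, ?_⟩
    · have h := hc.tendsto
      have h1 : (-(1 / 2 - ((0 : ℝ) : ℂ) * Complex.I) / (1 / 2 + ((0 : ℝ) : ℂ) * Complex.I) : ℂ) =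
          -1 := by norm_num
      rw [h1] at h
      exact h.mono_left nhdsWithin_le_nhds
    · filter_upwards [self_mem_nhdsWithin] with τ hτ
      exact (im_cross_pos hτ).le
  have h1 := Complex.tendsto_arg_nhdsWithin_im_nonneg_of_re_neg_of_im_zero (z := -1)
    (by simp) (by simp)
  exact h1.comp h0

theorem arg_cross_neg {τ : ℝ} (hτ : 0 < τ) :
    Complex.arg (-(1 / 2 - ((-τ : ℝ) : ℂ) * Complex.I) / (1 / 2 + ((-τ : ℝ) : ℂ) * Complex.I)) =
      -Complex.arg (-(1 / 2 - τ * Complex.I) / (1 / 2 + τ * Complex.I)) := by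
  have h1 : (-(1 / 2 - ((-τ : ℝ) : ℂ) * Complex.I) / (1 / 2 + ((-τ : ℝ) : ℂ) * Complex.I)) =
      (-(1 / 2 - τ * Complex.I) / (1 / 2 + τ * Complex.I))⁻¹ := by
    rw [inv_div, Complex.ofReal_neg, neg_mul, sub_neg_eq_add, neg_div, div_neg, ← sub_eq_add_neg]
  rw [h1, Complex.arg_inv, if_neg]
  rw [Complex.arg_eq_pi_iff]
  rintro ⟨-, h⟩
  exact (im_cross_pos hτ).ne' h

theorem viewAngle_sidePt (d : P.graph.Dart) (τ : ℝ) : P.viewAngle d (P.sidePt d τ) =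
    Complex.arg (-(1 / 2 - τ * Complex.I) / (1 / 2 + τ * Complex.I)) := by
  have h1 : P.pos d.snd - P.sidePt d τ = (1 / 2 - τ * Complex.I) * P.dir d := by
    simp only [sidePt, dir]; ring
  have h2 : P.pos d.fst - P.sidePt d τ = -(1 / 2 + τ * Complex.I) * P.dir d := by
    simp only [sidePt, dir]; ring
  rw [viewAngle, h1, h2, mul_div_mul_right _ _ (P.dir_ne_zero d), div_neg, neg_div]

theorem sidePt_zero_not_mem {d e : P.graph.Dart} (h1 : e ≠ d) (h2 : e ≠ d.symm) :
    P.sidePt d 0 ∉ segment ℝ (P.pos e.fst) (P.pos e.snd) := by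
  intro hmem
  have ha : ‖P.sidePt d 0 - P.pos d.fst‖ < 3 / 4 := by
    simp [sidePt, norm_dir]; norm_num
  have hb : ‖P.sidePt d 0 - P.pos d.snd‖ < 3 / 4 := by
    have : P.sidePt d 0 - P.pos d.snd = -(1 / 2) * P.dir d := by
      simp only [sidePt, dir]; push_cast; ring
    rw [this]
    simp [norm_dir]; norm_num
  have hne := d.adj.ne
  rcases P.eq_or_eq_of_mem_segment e.adj hmem ha with h | h <;>
    rcases P.eq_or_eq_of_mem_segment e.adj hmem hb with h' | h'
  · exact hne (h.trans h'.symm)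
  · exact h1 (SimpleGraph.Dart.ext _ _ (Prod.ext h.symm h'.symm))
  · exact h2 (SimpleGraph.Dart.ext _ _ (Prod.ext h'.symm h.symm))
  · exact hne (h.trans h'.symm)

-- At the midpoint of `d` only `d` and its reversal have a discontinuous view angle, and they jump
-- in opposite senses.
open Classical in
theorem tendsto_viewAngle_jump (d e : P.graph.Dart) :
    Tendsto (fun τ : ℝ => P.viewAngle e (P.sidePt d τ) - P.viewAngle e (P.sidePt d (-τ))) (𝓝[>] 0)
      (𝓝 ((if e = d then 2 * Real.pi else 0) - (if e = d.symm then 2 * Real.pi else 0))) := by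
  have hds : d ≠ d.symm := fun h => d.adj.ne (congrArg (fun x : P.graph.Dart => x.fst) h)
  have hdd : ∀ d : P.graph.Dart,
      Tendsto (fun τ : ℝ => P.viewAngle d (P.sidePt d τ) - P.viewAngle d (P.sidePt d (-τ))) (𝓝[>] 0)
        (𝓝 (2 * Real.pi)) := by
    intro d
    have h := tendsto_arg_cross.const_mul 2
    refine h.congr' ?_
    filter_upwards [self_mem_nhdsWithin] with τ hτ
    rw [P.viewAngle_sidePt, P.viewAngle_sidePt, arg_cross_neg hτ]
    ring
  by_cases h1 : e = d
  · subst h1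
    rw [if_pos rfl, if_neg hds, sub_zero]
    exact hdd e
  by_cases h2 : e = d.symm
  · subst h2
    rw [if_neg h1, if_pos rfl, zero_sub]
    refine (hdd d.symm).neg.congr fun τ => ?_
    rw [P.sidePt_symm, P.sidePt_symm, neg_neg, neg_sub]
  · rw [if_neg h1, if_neg h2]
    have hc := P.continuousAt_viewAngle (P.sidePt_zero_not_mem h1 h2)
    have hs : Continuous (P.sidePt d) := by unfold sidePt; fun_prop
    have t1 : Tendsto (fun τ : ℝ => P.viewAngle e (P.sidePt d τ)) (𝓝 0)
        (𝓝 (P.viewAngle e (P.sidePt d 0))) := hc.tendsto.comp hs.continuousAt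
    have t2 : Tendsto (fun τ : ℝ => P.viewAngle e (P.sidePt d (-τ))) (𝓝 0)
        (𝓝 (P.viewAngle e (P.sidePt d 0))) := by
      refine hc.tendsto.comp ?_
      have h := (hs.comp continuous_neg).tendsto 0
      rw [Function.comp_apply, neg_zero] at h
      exact h
    have := (t1.sub t2).mono_left (nhdsWithin_le_nhds (s := Set.Ioi 0))
    simpa using this

open Classical in
theorem winding_jump {O : Finset P.graph.Dart} (hO : O.image P.pred = O) (d : P.graph.Dart) :
    P.winding O (P.sectorPt d) - P.winding O (P.sectorPt d.symm) =
      (if d ∈ O then 2 * Real.pi else 0) - (if d.symm ∈ O then 2 * Real.pi else 0) := by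
  have h1 := tendsto_finsetSum O fun e _ => P.tendsto_viewAngle_jump d e
  rw [Finset.sum_sub_distrib, Finset.sum_ite_eq', Finset.sum_ite_eq'] at h1
  refine tendsto_nhds_unique (tendsto_const_nhds.congr' ?_) h1
  filter_upwards [P.eventually_sidePt_mem_sector d, P.eventually_sidePt_mem_sector d.symm]
    with τ ha hb
  rw [Finset.sum_sub_distrib, ← P.sidePt_symm]
  rw [← P.winding_eq_of_mem_faceOf hO (P.sector_subset_faceOf _ ha),
    ← P.winding_eq_of_mem_faceOf hO (P.sector_subset_faceOf _ hb)]
  rfl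

/-! ### Winding numbers are bounded by the distance -/

theorem abs_viewAngle_le {d : P.graph.Dart} {p : ℂ} (h : 2 ≤ ‖P.pos d.fst - p‖) :
    |P.viewAngle d p| ≤ 3 / 2 / ‖P.pos d.fst - p‖ := by
  have h0 : 0 < ‖P.pos d.fst - p‖ := by linarith
  have h1 : P.pos d.fst - p ≠ 0 := norm_pos_iff.1 h0
  have h2 : (P.pos d.snd - p) / (P.pos d.fst - p) = 1 + P.dir d / (P.pos d.fst - p) := by
    rw [dir]; field_simp; ring
  have h3 : ‖P.dir d / (P.pos d.fst - p)‖ = 1 / ‖P.pos d.fst - p‖ := by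
    rw [norm_div, norm_dir]
  have h4 : ‖P.dir d / (P.pos d.fst - p)‖ ≤ 1 / 2 := by
    rw [h3]; exact one_div_le_one_div_of_le (by norm_num) h
  -- The angle is the imaginary part of `log (1 + w)` with `‖w‖ ≤ 1/2`, where `‖log (1 + w)‖ ≤ 3/2 *
  -- ‖w‖`.
  have h5 := Complex.norm_log_one_add_half_le_self h4
  rw [viewAngle, h2, ← Complex.log_im]
  refine (Complex.abs_im_le_norm _).trans (h5.trans (le_of_eq ?_))
  rw [h3]; ring

-- Each of the `O.card` view angles is so small that the sum is at most 3/2 in absolute value, and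
-- the only multiple of 2π in that range is 0.
open Classical in
theorem winding_eq_zero_of_far {O : Finset P.graph.Dart} (hO : O.image P.pred = O) {p : ℂ}
    (hp : p ∉ P.net) (hfar : ∀ d ∈ O, O.card + 2 ≤ ‖P.pos d.fst - p‖) : P.winding O p = 0 := by
  obtain ⟨n, hn⟩ := P.winding_eq_int hO hp
  have hc : (0 : ℝ) ≤ O.card := Nat.cast_nonneg _
  have h1 : |P.winding O p| ≤ O.card * (3 / 2 / (O.card + 2)) := by
    rw [winding]
    refine (Finset.abs_sum_le_sum_abs _ _).trans ?_
    rw [← nsmul_eq_mul]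
    refine Finset.sum_le_card_nsmul _ _ _ fun d hd => ?_
    have h2 := hfar d hd
    refine (P.abs_viewAngle_le (by linarith)).trans ?_
    exact div_le_div_of_nonneg_left (by norm_num) (by linarith) h2
  have h2 : (O.card : ℝ) * (3 / 2 / (O.card + 2)) ≤ 3 / 2 := by
    rw [← mul_div_assoc, div_le_iff₀ (by linarith)]; nlinarith
  have h3 := Real.pi_gt_three
  rw [hn, abs_mul, abs_of_pos Real.two_pi_pos] at h1
  have h4 : |(n : ℝ)| < 1 := by
    by_contra hcon
    push Not at hcon
    nlinarith
  have h5 : |n| < 1 := by exact_mod_cast h4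
  rw [hn, Int.abs_lt_one_iff.1 h5]
  simp

/-! ### The winding number of a face boundary -/

/-- Reversal and `pred` generate `next`, so `g` depends only on the initial vertex. Reversal then
identifies the values at the two ends of each edge. -/
theorem eq_of_symm_pred_invariant {α : Type*} (hconn : P.graph.Connected) (g : P.graph.Dart → α)
    (hs : ∀ d : P.graph.Dart, g d.symm = g d) (hp : ∀ d, g (P.pred d) = g d)
    (d e : P.graph.Dart) : g d = g e := by
  have hn : ∀ d, g (P.next d) = g d := fun d => by rw [← hs, ← hp d]; rfl
  obtain ⟨w⟩ := hconn.preconnected d.fst e.fst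
  have key : ∀ {u v : V} (_ : P.graph.Walk u v) (d e : P.graph.Dart), d.fst = u → e.fst = v →
      g d = g e := by
    intro u v w
    induction w with
    | nil =>
      intro d e hd he
      exact P.eq_of_next_invariant g hn (hd.trans he.symm)
    | @cons u v w h _ ih =>
      intro d e hd he
      let f : P.graph.Dart := ⟨(u, v), h⟩
      rw [P.eq_of_next_invariant g hn (d := d) (e := f) hd, ← hs f]
      exact ih f.symm e rfl he
  exact key w d e rfl rfl

theorem exists_adj [Infinite V] (hconn : P.graph.Connected) (v : V) : ∃ w, P.graph.Adj v w := by
  obtain ⟨w, hw⟩ := exists_ne v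
  obtain ⟨p⟩ := hconn.preconnected v w
  cases p with
  | nil => exact absurd rfl hw
  | cons h _ => exact ⟨_, h⟩

-- The difference `g` of the two sides is unchanged under `pred`, which preserves the face, and
-- under reversal, by the jump formula. It is therefore constant on the connected graph, and it
-- vanishes at a dart far from `O`.
open Classical in
theorem winding_sectorPt [Infinite V] (hconn : P.graph.Connected) {O : Finset P.graph.Dart}
    (hO : O.image P.pred = O) (d : P.graph.Dart) :
    P.winding O (P.sectorPt d) = if d ∈ O then 2 * Real.pi else 0 := by
  have hmem : ∀ d, P.pred d ∈ O ↔ d ∈ O := by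
    intro d
    conv_lhs => rw [← hO]
    exact P.pred_injective.mem_finset_image
  have hw : ∀ d, P.winding O (P.sectorPt (P.pred d)) = P.winding O (P.sectorPt d) := by
    intro d
    refine P.winding_eq_of_mem_faceOf hO ?_
    rw [← P.faceOf_pred]
    exact P.sectorPt_mem_faceOf _
  let g : P.graph.Dart → ℝ := fun d => P.winding O (P.sectorPt d) - if d ∈ O then 2 * Real.pi else 0
  have hg := P.eq_of_symm_pred_invariant hconn g
    (fun d => by have := P.winding_jump hO d; simp only [g]; linarith)
    (fun d => by simp only [g, hw, hmem])
  -- Infinity of `V` provides a vertex outside this finite set. The radius exceeds `O.card + 2` by 1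
  -- to absorb the distance 1/4 from the vertex to its sector point.
  have hfin : (⋃ e ∈ O, {v | ‖P.pos v - P.pos e.fst‖ ≤ O.card + 3}).Finite :=
    Set.Finite.biUnion O.finite_toSet fun e _ =>
      P.unitSeparated_pos.finite_closedBall (P.pos e.fst) _
  obtain ⟨v, hv⟩ := hfin.exists_notMem
  simp only [Set.mem_iUnion, Set.mem_ofPred_eq, not_exists, not_le] at hv
  obtain ⟨w, hw⟩ := P.exists_adj hconn v
  let e : P.graph.Dart := ⟨(v, w), hw⟩
  have he : ‖P.sectorPt e - P.pos v‖ = 1 / 4 := P.norm_polarPt_sub e (by norm_num) _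
  have hfar : ∀ d ∈ O, O.card + 2 ≤ ‖P.pos d.fst - P.sectorPt e‖ := by
    intro d hd
    have h1 := hv d hd
    have h2 : ‖P.pos v - P.pos d.fst‖ ≤ ‖P.pos d.fst - P.sectorPt e‖ + ‖P.sectorPt e - P.pos v‖ := by
      rw [norm_sub_rev (P.pos v)]
      exact norm_sub_le_norm_sub_add_norm_sub _ _ _
    linarith
  have heO : e ∉ O := by
    intro h
    have h1 := hfar e h
    rw [norm_sub_rev] at h1
    change _ ≤ ‖P.sectorPt e - P.pos v‖ at h1
    rw [he] at h1
    linarith [(Nat.cast_nonneg O.card : (0 : ℝ) ≤ O.card)]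
  have h1 : g e = 0 := by
    simp only [g]
    rw [if_neg heO, P.winding_eq_zero_of_far hO (P.sectorPt_not_mem_net e) hfar, sub_zero]
  have h2 := hg d e
  rw [h1] at h2
  exact sub_eq_zero.1 h2

open Classical in
/-- Darts with the same face on their left lie on the same boundary walk. -/
theorem mem_of_faceOf_eq [Infinite V] (hconn : P.graph.Connected) {O : Finset P.graph.Dart}
    (hO : O.image P.pred = O) {d e : P.graph.Dart} (h : P.faceOf d = P.faceOf e) (hd : d ∈ O) :
    e ∈ O := by
  have h1 := P.winding_eq_of_mem_faceOf hO (h ▸ P.sectorPt_mem_faceOf d)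
  rw [P.winding_sectorPt hconn hO, P.winding_sectorPt hconn hO, if_pos hd] at h1
  by_contra he
  rw [if_neg he] at h1
  exact Real.two_pi_pos.ne' h1

open Classical in
/-- A face lies near its boundary walk. -/
theorem exists_near_of_mem_faceOf [Infinite V] (hconn : P.graph.Connected)
    {O : Finset P.graph.Dart} (hO : O.image P.pred = O) {d : P.graph.Dart} (hd : d ∈ O) {p : ℂ}
    (hp : p ∈ P.faceOf d) : ∃ e ∈ O, ‖P.pos e.fst - p‖ < O.card + 2 := by
  by_contra hcon
  push Not at hcon
  have h1 := P.winding_eq_zero_of_far hO (connectedComponentIn_subset _ _ hp) hcon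
  rw [P.winding_eq_of_mem_faceOf hO hp, P.winding_sectorPt hconn hO, if_pos hd] at h1
  exact Real.two_pi_pos.ne' h1

end PennyConfiguration

/-! ### Chains of bounded steps in a bounded set -/

namespace SimpleGraph

variable {V : Type*} {G : SimpleGraph V}

theorem Connected.dist_le_mul_length (hG : G.Connected) {H : SimpleGraph V} {N : ℕ}
    (hH : ∀ a b, H.Adj a b → G.dist a b ≤ N) {v w : V} (p : H.Walk v w) :
    G.dist v w ≤ N * p.length := by
  induction p with
  | nil => simp
  | @cons u v w h p ih =>
    rw [Walk.length_cons]
    have h1 := hG.dist_triangle (u := u) (v := v) (w := w)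
    have h2 := hH _ _ h
    calc G.dist u w ≤ N + N * p.length := by lia
      _ = _ := by ring

/-- A chain may be arbitrarily long, but shortening it to a path without repeated vertices leaves at
most `U.card` steps. -/
theorem Connected.dist_le_of_reflTransGen (hG : G.Connected) {r : V → V → Prop} {U : Finset V}
    {N : ℕ} (hr : ∀ a b, r a b → a ∈ U ∧ b ∈ U ∧ G.dist a b ≤ N) {v w : V}
    (h : Relation.ReflTransGen r v w) : G.dist v w ≤ N * U.card := by
  classical
  let H := SimpleGraph.fromRel r
  have hH : ∀ a b, H.Adj a b → a ∈ U ∧ b ∈ U ∧ G.dist a b ≤ N := by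
    intro a b hab
    rcases ((SimpleGraph.fromRel_adj r a b).1 hab).2 with h | h
    · exact hr a b h
    · obtain ⟨h1, h2, h3⟩ := hr b a h
      exact ⟨h2, h1, by rwa [G.dist_comm]⟩
  have hreach : H.Reachable v w := by
    induction h with
    | refl => exact Reachable.refl _
    | @tail b c _ hbc ih =>
      by_cases heq : b = c
      · exact heq ▸ ih
      · exact ih.trans (Adj.reachable ((SimpleGraph.fromRel_adj r b c).2 ⟨heq, Or.inl hbc⟩))
  obtain ⟨p, hp⟩ := hreach.exists_isPath
  have htail : ∀ {v w : V} (p : H.Walk v w), ∀ x ∈ p.support.tail, x ∈ U := by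
    intro v w p
    induction p with
    | nil => simp
    | @cons u v w h p ih =>
      intro x hx
      rw [Walk.support_cons, List.tail_cons, Walk.mem_support_iff] at hx
      rcases hx with rfl | hx
      · exact (hH _ _ h).2.1
      · exact ih x hx
  have hlen : p.length ≤ U.card := by
    have h1 : p.support.tail.length = p.length := by simp
    rw [← h1, ← List.toFinset_card_of_nodup hp.support_nodup.tail]
    exact Finset.card_le_card fun x hx => htail p x (by simpa using hx)
  exact (hG.dist_le_mul_length (fun a b hab => (hH a b hab).2.2) p).trans
    (Nat.mul_le_mul_left _ hlen)

end SimpleGraph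

namespace PennyConfiguration

open Filter Topology

variable {V : Type*} (P : PennyConfiguration V)

/-! ### Faces of bounded degree -/

/-- Every face meets at most `D` pennies. -/
def FaceBound (D : ℕ) : Prop :=
  ∀ d : P.graph.Dart, {v | ∃ q ∈ P.faceOf d, ‖q - P.pos v‖ < 1 / 2}.encard ≤ D

theorem planeEquiv_mem_net_iff [Infinite V] (hconn : P.graph.Connected) (p : Plane) :
    planeEquiv p ∈ P.net ↔ p ∈ P.skeleton := by
  have hseg : ∀ v w : V, planeEquiv p ∈ segment ℝ (P.pos v) (P.pos w) ↔
      p ∈ segment ℝ (P.center v) (P.center w) := by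
    intro v w
    have h := image_segment ℝ planeEquiv.toLinearEquiv.toLinearMap.toAffineMap
      (P.center v) (P.center w)
    change planeEquiv '' _ = segment ℝ (P.pos v) (P.pos w) at h
    rw [← h, planeEquiv.injective.mem_set_image]
  simp only [net, skeleton, Set.mem_ofPred_eq, Set.mem_union, hseg]
  refine ⟨Or.inr, ?_⟩
  rintro (⟨v, rfl⟩ | h)
  · obtain ⟨w, hw⟩ := P.exists_adj hconn v
    exact ⟨v, w, hw, left_mem_segment _ _ _⟩
  · exact h

/-- Each penny that the face meets contributes at least one corner, namely the component of the cut
disk that contains a chosen point of the face. Different pennies give different corners. -/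
theorem faceBound_of_facialDegree_le [Infinite V] (hconn : P.graph.Connected) {D : ℕ}
    (hD : ∀ σ ∈ P.faces, P.facialDegree σ ≤ (D : ℕ∞)) : P.FaceBound D := by
  intro d
  have hmem : ∀ q : ℂ, planeEquiv.symm q ∈ P.skeletonᶜ ↔ q ∉ P.net := by
    intro q
    rw [Set.mem_compl_iff, ← P.planeEquiv_mem_net_iff hconn, planeEquiv.apply_symm_apply]
  let z : Plane := planeEquiv.symm (P.sectorPt d)
  let σ : Set Plane := connectedComponentIn P.skeletonᶜ z
  have hσ : σ ∈ P.faces := ⟨z, (hmem _).2 (P.sectorPt_not_mem_net d), rfl⟩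
  have hface : ∀ q ∈ P.faceOf d, planeEquiv.symm q ∈ σ := by
    intro q hq
    have h1 : IsPreconnected (planeEquiv.symm '' P.faceOf d) :=
      isPreconnected_connectedComponentIn.image _ planeEquiv.symm.continuous.continuousOn
    refine h1.subset_connectedComponentIn ⟨_, P.sectorPt_mem_faceOf d, rfl⟩ ?_ ⟨q, hq, rfl⟩
    rintro _ ⟨x, hx, rfl⟩
    exact (hmem x).2 (connectedComponentIn_subset _ _ hx)
  refine le_trans ?_ (hD σ hσ)
  have hch : ∀ v : {v | ∃ q ∈ P.faceOf d, ‖q - P.pos v‖ < 1 / 2},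
      ∃ q ∈ P.faceOf d, ‖q - P.pos v‖ < 1 / 2 := fun v => v.2
  choose q hq1 hq2 using hch
  classical
  let corner : V → V × Set Plane := fun v =>
    if hv : v ∈ {v | ∃ q ∈ P.faceOf d, ‖q - P.pos v‖ < 1 / 2} then
      (v, connectedComponentIn (P.disk v \ P.skeleton) (planeEquiv.symm (q ⟨v, hv⟩)))
    else (v, ∅)
  have hfst : ∀ v, (corner v).1 = v := by
    intro v
    simp only [corner]
    split_ifs <;> rfl
  refine Set.encard_le_encard_of_injOn (f := corner) ?_ ?_
  · intro v hv
    have hd : planeEquiv.symm (q ⟨v, hv⟩) ∈ P.disk v \ P.skeleton := by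
      refine ⟨?_, (hmem _).2 (connectedComponentIn_subset _ _ (hq1 _))⟩
      rw [disk, Metric.mem_ball, ← planeEquiv.dist_map, planeEquiv.apply_symm_apply,
        dist_eq_norm]
      exact hq2 ⟨v, hv⟩
    have hc : corner v =
        (v, connectedComponentIn (P.disk v \ P.skeleton) (planeEquiv.symm (q ⟨v, hv⟩))) :=
      dif_pos hv
    rw [hc]
    refine ⟨⟨_, hd, rfl⟩, ?_⟩
    have h1 : σ = connectedComponentIn P.skeletonᶜ (planeEquiv.symm (q ⟨v, hv⟩)) :=
      connectedComponentIn_eq (hface _ (hq1 _))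
    rw [h1]
    exact connectedComponentIn_mono _ fun x hx => hx.2
  · intro v _ w _ h
    rw [← hfst v, h, hfst w]

theorem norm_pos_sub_le_dist (hconn : P.graph.Connected) (v w : V) :
    ‖P.pos v - P.pos w‖ ≤ P.graph.dist v w := by
  obtain ⟨p, hp⟩ := hconn.exists_walk_length_eq_dist v w
  rw [← hp]
  clear hp
  induction p with
  | nil => simp
  | @cons u v w h p ih =>
    have h1 := P.norm_of_adj h.symm
    have h2 := norm_sub_le_norm_sub_add_norm_sub (P.pos u) (P.pos v) (P.pos w)
    rw [SimpleGraph.Walk.length_cons]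
    push_cast
    linarith

theorem faceOf_iterate_pred (d : P.graph.Dart) (k : ℕ) :
    P.faceOf (P.pred^[k] d) = P.faceOf d := by
  induction k with
  | zero => rfl
  | succ k ih => rw [Function.iterate_succ_apply', P.faceOf_pred, ih]

open Classical in
theorem card_darts_le (v : V) (s : Finset P.graph.Dart) (hs : ∀ d ∈ s, d.fst = v) :
    s.card ≤ 49 := by
  have hinj : Set.InjOn (fun d : P.graph.Dart => d.snd) s := by
    intro d hd e he h
    exact SimpleGraph.Dart.ext _ _ (Prod.ext ((hs d hd).trans (hs e he).symm) h)
  rw [← Finset.card_image_of_injOn hinj]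
  have h := P.unitSeparated_pos.card_le (P.pos v) zero_le_one (s.image fun d => d.snd) (by
    intro w hw
    obtain ⟨d, hd, rfl⟩ := Finset.mem_image.1 hw
    rw [← hs d hd]
    exact (P.norm_of_adj d.adj).le)
  norm_num at h
  exact_mod_cast h

open Classical in
/-- The boundary walk of a face. -/
theorem exists_boundary {D : ℕ} (hD : P.FaceBound D) (d : P.graph.Dart) :
    ∃ O : Finset P.graph.Dart, O.image P.pred = O ∧ d ∈ O ∧ (∀ e ∈ O, ∃ k, P.pred^[k] d = e) ∧
      O.card ≤ 49 * D ∧ (O.image fun e => e.fst).card ≤ D := by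
  have hT := hD d
  set T : Set V := {v | ∃ q ∈ P.faceOf d, ‖q - P.pos v‖ < 1 / 2} with hTdef
  have hTf : T.Finite := Set.finite_of_encard_le_coe hT
  have hTn : hTf.toFinset.card ≤ D := by
    rw [hTf.encard_eq_coe_toFinset_card] at hT
    exact_mod_cast hT
  have hmem : ∀ k, (P.pred^[k] d).fst ∈ T := by
    intro k
    refine ⟨P.sectorPt (P.pred^[k] d), ?_, ?_⟩
    · rw [← P.faceOf_iterate_pred d k]
      exact P.sectorPt_mem_faceOf _
    · rw [sectorPt, P.norm_polarPt_sub _ (by norm_num)]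
      norm_num
  -- All iterates have the same face on their left, so they start at the at most `D` vertices of
  -- `T`, each of finite degree.
  have hfin : (Set.range fun k => P.pred^[k] d).Finite := by
    refine (Set.Finite.biUnion hTf fun v _ => P.finite_darts v).subset ?_
    rintro _ ⟨k, rfl⟩
    exact Set.mem_biUnion (hmem k) rfl
  have hO : ∀ e, e ∈ hfin.toFinset ↔ ∃ k, P.pred^[k] d = e := by simp
  have himg : (hfin.toFinset.image fun e => e.fst).card ≤ D := by
    refine (Finset.card_le_card ?_).trans hTn
    intro v hv
    obtain ⟨e, he, rfl⟩ := Finset.mem_image.1 hv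
    obtain ⟨k, rfl⟩ := (hO e).1 he
    simpa using hmem k
  refine ⟨hfin.toFinset, ?_, (hO d).2 ⟨0, rfl⟩, fun e he => (hO e).1 he, ?_, himg⟩
  -- The forward orbit is mapped into itself by an injection and is finite, so it is mapped onto
  -- itself.
  · refine Finset.eq_of_subset_of_card_le ?_ ?_
    · intro e he
      obtain ⟨f, hf, rfl⟩ := Finset.mem_image.1 he
      obtain ⟨k, rfl⟩ := (hO f).1 hf
      exact (hO _).2 ⟨k + 1, Function.iterate_succ_apply' _ _ _⟩
    · rw [Finset.card_image_of_injective _ P.pred_injective]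
  · refine (Finset.card_le_mul_card_image (f := fun e : P.graph.Dart => e.fst) _ 49 ?_).trans
      (Nat.mul_le_mul_left _ himg)
    intro v _
    exact P.card_darts_le v _ fun e he => (Finset.mem_filter.1 he).2

-- Consecutive darts of a boundary walk start at adjacent vertices, so the walk is a chain with
-- steps of length one among at most `D` vertices.
variable {P} in
open Classical in
theorem FaceBound.dist_le_of_mem_boundary {D : ℕ} (hconn : P.graph.Connected)
    {d : P.graph.Dart} {O : Finset P.graph.Dart} (hO : O.image P.pred = O) (hd : d ∈ O)
    (hk : ∀ e ∈ O, ∃ k, P.pred^[k] d = e) (hcard : (O.image fun e => e.fst).card ≤ D)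
    {e : P.graph.Dart} (he : e ∈ O) : P.graph.dist d.fst e.fst ≤ D := by
  have hit : ∀ k, P.pred^[k] d ∈ O := by
    intro k
    induction k with
    | zero => exact hd
    | succ k ih =>
      rw [Function.iterate_succ_apply', ← hO]
      exact Finset.mem_image_of_mem _ ih
  obtain ⟨k, rfl⟩ := hk e he
  have hmem : ∀ e ∈ O, e.fst ∈ O.image fun e => e.fst := fun e he => Finset.mem_image_of_mem _ he
  have hchain : Relation.ReflTransGen (fun a b => a ∈ O.image (fun e => e.fst) ∧
      b ∈ O.image (fun e => e.fst) ∧ P.graph.dist a b ≤ 1) d.fst (P.pred^[k] d).fst := by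
    clear he
    induction k with
    | zero => exact Relation.ReflTransGen.refl
    | succ k ih =>
      refine ih.tail ⟨hmem _ (hit k), hmem _ (hit (k + 1)), ?_⟩
      rw [Function.iterate_succ_apply']
      have h := (P.pred (P.pred^[k] d)).adj
      rw [P.pred_snd] at h
      exact (SimpleGraph.dist_eq_one_iff_adj.2 h.symm).le
  have h := hconn.dist_le_of_reflTransGen (fun a b h => h) hchain
  rw [one_mul] at h
  exact h.trans hcard

variable {P} in
theorem FaceBound.dist_le [Infinite V] {D : ℕ} (hD : P.FaceBound D) (hconn : P.graph.Connected)
    {d e : P.graph.Dart} (h : P.faceOf d = P.faceOf e) : P.graph.dist d.fst e.fst ≤ D := by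
  obtain ⟨O, hO, hd, hk, -, hcard⟩ := P.exists_boundary hD d
  exact FaceBound.dist_le_of_mem_boundary hconn hO hd hk hcard (P.mem_of_faceOf_eq hconn hO h hd)

variable {P} in
theorem FaceBound.norm_sub_le [Infinite V] {D : ℕ} (hD : P.FaceBound D) (hconn : P.graph.Connected)
    {d : P.graph.Dart} {q : ℂ} (h : q ∈ P.faceOf d) : ‖P.pos d.fst - q‖ ≤ 50 * D + 2 := by
  obtain ⟨O, hO, hd, hk, hcO, hcard⟩ := P.exists_boundary hD d
  -- The constant splits as `D` along the boundary from `d` to `e`, and `49 * D + 2` from `e` to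
  -- `q`.
  obtain ⟨e, he, hnear⟩ := P.exists_near_of_mem_faceOf hconn hO hd h
  have h1 := FaceBound.dist_le_of_mem_boundary hconn hO hd hk hcard he
  have h2 := P.norm_pos_sub_le_dist hconn d.fst e.fst
  have h3 : (P.graph.dist d.fst e.fst : ℝ) ≤ D := by exact_mod_cast h1
  have h4 : (O.card : ℝ) ≤ 49 * D := by exact_mod_cast hcO
  have h5 := norm_sub_le_norm_sub_add_norm_sub (P.pos d.fst) (P.pos e.fst) q
  linarith

/-! ### The vertices around a point of the plane -/

/-- The vertices on the boundary of the face of `q`, and those at distance less than `3/4`. -/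
def around (q : ℂ) : Set V :=
  {a | (∃ d : P.graph.Dart, d.fst = a ∧ q ∈ P.faceOf d) ∨ ‖q - P.pos a‖ < 3 / 4}

theorem mem_around_pos (v : V) : v ∈ P.around (P.pos v) := by
  right; simp

theorem exists_half_near {p : ℂ} (hp : p ∈ P.net) : ∃ a, ‖p - P.pos a‖ ≤ 1 / 2 := by
  obtain ⟨v, w, h, hp⟩ := hp
  rw [segment_eq_image'] at hp
  obtain ⟨t, ht, rfl⟩ := hp
  have hn := P.norm_of_adj h
  rcases le_total t (1 / 2) with h1 | h1
  · refine ⟨v, ?_⟩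
    simp only [add_sub_cancel_left, norm_smul, hn, Real.norm_of_nonneg ht.1]
    linarith
  · refine ⟨w, ?_⟩
    have e : P.pos v + t • (P.pos w - P.pos v) - P.pos w =
        (-(1 - t)) • (P.pos w - P.pos v) := by
      simp only [Complex.real_smul]; push_cast; ring
    simp only [e, norm_smul, hn, norm_neg, Real.norm_of_nonneg (sub_nonneg.2 ht.2)]
    linarith

variable [Infinite V]

theorem mem_around_of_near (hconn : P.graph.Connected) {a : V} {q : ℂ} (hq : q ∉ P.net)
    (hqa : ‖q - P.pos a‖ < 3 / 4) : ∃ d : P.graph.Dart, d.fst = a ∧ q ∈ P.faceOf d := by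
  obtain ⟨d, hd, hqd⟩ := P.exists_mem_sector (P.exists_adj hconn a) hq hqa
  exact ⟨d, hd, P.sector_subset_faceOf d hqd⟩

/-- Off the net, the segment from `q` towards a nearest point `p` of the net stays in the face of
`q`. Close to `p` it enters a sector at a vertex, because `p` is within 1/2 of a vertex. -/
theorem around_nonempty (hconn : P.graph.Connected) (q : ℂ) : (P.around q).Nonempty := by
  by_cases hq : q ∈ P.net
  · obtain ⟨a, ha⟩ := P.exists_half_near hq
    exact ⟨a, Or.inr (by linarith)⟩
  have hne : P.net.Nonempty := by
    obtain ⟨v⟩ := hconn.nonempty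
    obtain ⟨w, hw⟩ := P.exists_adj hconn v
    exact ⟨_, v, w, hw, left_mem_segment _ _ _⟩
  obtain ⟨p, hp, hdist⟩ := P.isClosed_net.exists_infDist_eq_dist hne q
  have hpq : 0 < dist q p := dist_pos.2 fun h => hq (h ▸ hp)
  obtain ⟨a, ha⟩ := P.exists_half_near hp
  obtain ⟨s, hs0, hs1, hs⟩ : ∃ s : ℝ, 0 < s ∧ s ≤ 1 ∧ s * dist q p < 1 / 4 := by
    refine ⟨min 1 (1 / (8 * dist q p)), by positivity, min_le_left _ _, ?_⟩
    calc min 1 (1 / (8 * dist q p)) * dist q p ≤ 1 / (8 * dist q p) * dist q p := by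
          gcongr; exact min_le_right _ _
      _ = 1 / 8 := by field_simp
      _ < 1 / 4 := by norm_num
  have hsub : (fun t : ℝ => p + t • (q - p)) '' Set.Icc s 1 ⊆ P.netᶜ := by
    rintro _ ⟨t, ht, rfl⟩ hmem
    have h1 := Metric.infDist_le_dist_of_mem (x := q) hmem
    have h2 : dist q (p + t • (q - p)) = (1 - t) * dist q p := by
      have e : q - (p + t • (q - p)) = (1 - t) • (q - p) := by
        simp only [Complex.real_smul]; push_cast; ring
      rw [dist_eq_norm, e, norm_smul, dist_eq_norm, Real.norm_of_nonneg (by linarith [ht.2])]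
    rw [hdist, h2] at h1
    nlinarith [ht.1]
  have hpre : IsPreconnected ((fun t : ℝ => p + t • (q - p)) '' Set.Icc s 1) :=
    isPreconnected_Icc.image _ (by fun_prop)
  have hq' : p + s • (q - p) ∈ (fun t : ℝ => p + t • (q - p)) '' Set.Icc s 1 :=
    ⟨s, ⟨le_rfl, hs1⟩, rfl⟩
  have hnear : ‖p + s • (q - p) - P.pos a‖ < 3 / 4 := by
    have e : p + s • (q - p) - P.pos a = (p - P.pos a) + s • (q - p) := by ring
    rw [e]
    refine (norm_add_le _ _).trans_lt ?_
    rw [norm_smul, Real.norm_of_nonneg hs0.le, ← dist_eq_norm q p]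
    linarith
  obtain ⟨d, hd, hdq⟩ := P.mem_around_of_near hconn (hsub hq') hnear
  refine ⟨a, Or.inl ⟨d, hd, ?_⟩⟩
  rw [P.faceOf_eq_of_mem hdq]
  exact hpre.subset_connectedComponentIn hq' hsub ⟨1, ⟨hs1, le_rfl⟩, by simp⟩

/-- On the net, a vertex within 1/2 of `p` stays within 3/4 of nearby points. Off the net, nearby
points lie in the face of `p`. This local overlap is what chains vertices along a segment. -/
theorem eventually_around (hconn : P.graph.Connected) (p : ℂ) :
    ∀ᶠ q in 𝓝 p, (P.around p ∩ P.around q).Nonempty := by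
  by_cases hp : p ∈ P.net
  · obtain ⟨a, ha⟩ := P.exists_half_near hp
    filter_upwards [Metric.ball_mem_nhds p (show (0 : ℝ) < 1 / 4 by norm_num)] with q hq
    refine ⟨a, Or.inr (by linarith), Or.inr ?_⟩
    rw [mem_ball_iff_norm] at hq
    linarith [norm_sub_le_norm_sub_add_norm_sub q p (P.pos a)]
  · obtain ⟨r, hr, hsub⟩ := Metric.isOpen_iff.1 P.isClosed_net.isOpen_compl p hp
    have hpre : IsPreconnected (Metric.ball p r) := (convex_ball p r).isPreconnected
    obtain ⟨a, ha⟩ := P.around_nonempty hconn p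
    obtain ⟨d, hd, hdp⟩ : ∃ d : P.graph.Dart, d.fst = a ∧ p ∈ P.faceOf d := by
      rcases ha with h | h
      · exact h
      · exact P.mem_around_of_near hconn hp h
    filter_upwards [Metric.ball_mem_nhds p hr] with q hq
    refine ⟨a, ha, Or.inl ⟨d, hd, ?_⟩⟩
    rw [P.faceOf_eq_of_mem hdp]
    exact hpre.subset_connectedComponentIn (Metric.mem_ball_self hr) hsub hq

variable {P} {D : ℕ}

theorem FaceBound.dist_le_of_mem_around (hD : P.FaceBound D) (hconn : P.graph.Connected) {q : ℂ}
    {a b : V} (ha : a ∈ P.around q) (hb : b ∈ P.around q) : P.graph.dist a b ≤ D + 1 := by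
  by_cases hq : q ∈ P.net
  · have hno : ∀ d : P.graph.Dart, q ∉ P.faceOf d := fun d h => connectedComponentIn_subset _ _ h hq
    have ha : ‖q - P.pos a‖ < 3 / 4 := ha.resolve_left fun ⟨d, _, h⟩ => hno d h
    have hb : ‖q - P.pos b‖ < 3 / 4 := hb.resolve_left fun ⟨d, _, h⟩ => hno d h
    obtain ⟨v, w, h, hmem⟩ := hq
    have h1 : P.graph.dist v w = 1 := SimpleGraph.dist_eq_one_iff_adj.2 h
    have h2 : P.graph.dist w v = 1 := SimpleGraph.dist_eq_one_iff_adj.2 h.symm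
    rcases P.eq_or_eq_of_mem_segment h hmem ha with rfl | rfl <;>
      rcases P.eq_or_eq_of_mem_segment h hmem hb with rfl | rfl <;> simp [h1, h2]
  · have key : ∀ a ∈ P.around q, ∃ d : P.graph.Dart, d.fst = a ∧ q ∈ P.faceOf d := by
      rintro a (h | h)
      · exact h
      · exact P.mem_around_of_near hconn hq h
    obtain ⟨d, rfl, hd⟩ := key a ha
    obtain ⟨e, rfl, he⟩ := key b hb
    exact (hD.dist_le hconn (P.faceOf_eq_of_mem_of_mem hd he)).trans (Nat.le_succ D)

theorem FaceBound.norm_sub_le_of_mem_around (hD : P.FaceBound D) (hconn : P.graph.Connected)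
    {q : ℂ} {a : V} (ha : a ∈ P.around q) : ‖P.pos a - q‖ ≤ 50 * D + 2 := by
  rcases ha with ⟨d, rfl, hd⟩ | h
  · exact hD.norm_sub_le hconn hd
  · rw [norm_sub_rev]
    linarith [(Nat.cast_nonneg D : (0 : ℝ) ≤ D)]

/-- Vertices around nearby points are close to each other in the graph. -/
theorem FaceBound.dist_le_of_near (hD : P.FaceBound D) (hconn : P.graph.Connected) {p q : ℂ}
    (hpq : ‖p - q‖ ≤ 2) {a b : V} (ha : a ∈ P.around p) (hb : b ∈ P.around q) :
    P.graph.dist a b ≤ (D + 1) * (200 * D + 19) ^ 2 := by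
  let r : V → V → Prop := fun a b => ∃ x ∈ segment ℝ p q, a ∈ P.around x ∧ b ∈ P.around x
  have hr : ∀ x ∈ segment ℝ p q, ∀ a ∈ P.around x, ∀ b ∈ P.around x, r a b :=
    fun x hx a ha b hb => ⟨x, hx, ha, hb⟩
  have hsymm : Std.Symm r := ⟨fun _ _ ⟨x, hx, h1, h2⟩ => ⟨x, hx, h2, h1⟩⟩
  have hchain : Relation.ReflTransGen r a b := by
    -- Local overlap of the sets `around` propagates along the connected segment to a chain from `a`
    -- to `b`.
    refine (convex_segment p q).isPreconnected.induction₂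
      (fun x y => ∀ a ∈ P.around x, ∀ b ∈ P.around y, Relation.ReflTransGen r a b)
      ?_ ?_ ?_ (left_mem_segment ℝ p q) (right_mem_segment ℝ p q) a ha b hb
    · intro x hx
      filter_upwards [nhdsWithin_le_nhds (P.eventually_around hconn x), self_mem_nhdsWithin]
        with y ⟨c, hcx, hcy⟩ hy a ha b hb
      exact (Relation.ReflTransGen.single (hr x hx a ha c hcx)).tail (hr y hy c hcy b hb)
    · intro x y z _ _ _ hxy hyz a ha b hb
      obtain ⟨c, hc⟩ := P.around_nonempty hconn y
      exact (hxy a ha c hc).trans (hyz c hc b hb)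
    · intro x y _ _ hxy a ha b hb
      exact (Relation.ReflTransGen.stdSymm (r := r)).symm _ _ (hxy b hb a ha)
  -- Every vertex of the chain is within `50 * D + 2` of a point of the segment, which is within 2
  -- of `p`. The packing bound for this disk is `(200 * D + 19) ^ 2`.
  have hf := P.unitSeparated_pos.finite_closedBall p (50 * D + 4)
  have hU : ∀ x ∈ segment ℝ p q, ∀ a ∈ P.around x, a ∈ hf.toFinset := by
    intro x hx a ha
    have h1 := hD.norm_sub_le_of_mem_around hconn ha
    have h2 : ‖x - p‖ ≤ 2 := by
      refine le_trans ?_ hpq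
      rw [norm_sub_rev p q]
      exact norm_sub_le_of_mem_segment hx
    simp only [Set.Finite.mem_toFinset, Set.mem_ofPred_eq]
    linarith [norm_sub_le_norm_sub_add_norm_sub (P.pos a) x p]
  have h1 := hconn.dist_le_of_reflTransGen (U := hf.toFinset) (N := D + 1) (r := r)
    (fun a b ⟨x, hx, h1, h2⟩ => ⟨hU x hx a h1, hU x hx b h2,
      hD.dist_le_of_mem_around hconn h1 h2⟩) hchain
  refine h1.trans (Nat.mul_le_mul_left _ ?_)
  have h2 := P.unitSeparated_pos.card_le p (r := 50 * D + 4) (by positivity) hf.toFinset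
    (fun v hv => by simpa using hv)
  have h3 : (4 * (50 * (D : ℝ) + 4) + 3) ^ 2 = (((200 * D + 19) ^ 2 : ℕ) : ℝ) := by
    push_cast; ring
  rw [h3] at h2
  exact_mod_cast h2

end PennyConfiguration

/-! ### Sums of squares on an integer grid -/

/-- Telescoping and Cauchy–Schwarz. The sum on the right includes the step from `hi` to `hi + 1`,
which is harmless slack. -/
theorem sq_sub_le_sum_steps (g : ℤ → ℝ) {lo hi s t : ℤ} (hs : s ∈ Finset.Icc lo hi)
    (ht : t ∈ Finset.Icc lo hi) :
    (g s - g t) ^ 2 ≤ (Finset.Icc lo hi).card * ∑ k ∈ Finset.Icc lo hi, (g (k + 1) - g k) ^ 2 := by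
  wlog hst : s ≤ t generalizing s t
  · have := this ht hs (by lia)
    rwa [← neg_sub, neg_sq] at this
  rw [Finset.mem_Icc] at hs ht
  obtain ⟨m, rfl⟩ : ∃ m : ℕ, t = s + m := ⟨(t - s).toNat, by lia⟩
  have h1 := Finset.sum_range_sub (fun k : ℕ => g (s + k)) m
  have h2 : g s - g (s + m) = -∑ k ∈ Finset.range m, (g (s + k + 1) - g (s + k)) := by
    simp only [Nat.cast_add, Nat.cast_one, Nat.cast_zero, add_zero, ← add_assoc] at h1
    rw [h1]; ring
  rw [h2, neg_sq]
  refine (sq_sum_le_card_mul_sum_sq (s := Finset.range m)).trans ?_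
  have hinj : Set.InjOn (fun k : ℕ => s + (k : ℤ)) (Finset.range m) := by
    intro a _ b _ hab
    simpa using hab
  have hsub : (Finset.range m).image (fun k : ℕ => s + (k : ℤ)) ⊆ Finset.Icc lo hi := by
    intro x hx
    obtain ⟨k, hk, rfl⟩ := Finset.mem_image.1 hx
    rw [Finset.mem_range] at hk
    rw [Finset.mem_Icc]
    lia
  have hcard := Finset.card_le_card hsub
  rw [Finset.card_image_of_injOn hinj] at hcard
  have hsum : ∑ k ∈ Finset.range m, (g (s + k + 1) - g (s + k)) ^ 2 ≤
      ∑ k ∈ Finset.Icc lo hi, (g (k + 1) - g k) ^ 2 := by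
    rw [← Finset.sum_image (f := fun k : ℤ => (g (k + 1) - g k) ^ 2) hinj]
    exact Finset.sum_le_sum_of_subset_of_nonneg hsub fun _ _ _ => sq_nonneg _
  exact mul_le_mul (by exact_mod_cast hcard) hsum (Finset.sum_nonneg fun _ _ => sq_nonneg _)
    (Nat.cast_nonneg _)

/-- The Poincaré inequality on a square of the integer grid. -/
theorem sum_sq_sub_le_grid (F : ℤ × ℤ → ℝ) {X Y : Finset ℤ} {N : ℕ} {a b a' b' : ℤ}
    (hX : X = Finset.Icc a b) (hY : Y = Finset.Icc a' b') (hXN : X.card = N) (hYN : Y.card = N) :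
    ∑ i ∈ X ×ˢ Y, ∑ j ∈ X ×ˢ Y, (F i - F j) ^ 2 ≤ 2 * N ^ 4 *
      ∑ i ∈ X ×ˢ Y, ((F (i.1 + 1, i.2) - F i) ^ 2 + (F (i.1, i.2 + 1) - F i) ^ 2) := by
  -- The points are joined by an L-shaped path, along the row of `i` and then the column of `j`.
  -- Each step then occurs for `N ^ 3` pairs `(i, j)`, with weight `2 * N`.
  have h1 : ∀ i ∈ X ×ˢ Y, ∀ j ∈ X ×ˢ Y, (F i - F j) ^ 2 ≤
      2 * (N * ∑ k ∈ X, (F (k + 1, i.2) - F (k, i.2)) ^ 2) +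
      2 * (N * ∑ k ∈ Y, (F (j.1, k + 1) - F (j.1, k)) ^ 2) := by
    intro i hi j hj
    rw [Finset.mem_product] at hi hj
    have e1 := sq_sub_le_sum_steps (fun k => F (k, i.2)) (hX ▸ hi.1) (hX ▸ hj.1)
    have e2 := sq_sub_le_sum_steps (fun k => F (j.1, k)) (hY ▸ hi.2) (hY ▸ hj.2)
    rw [← hX, hXN] at e1
    rw [← hY, hYN] at e2
    have e3 : (F i - F j) ^ 2 ≤ 2 * (F (i.1, i.2) - F (j.1, i.2)) ^ 2 +
        2 * (F (j.1, i.2) - F (j.1, j.2)) ^ 2 := by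
      have : F i - F j = (F (i.1, i.2) - F (j.1, i.2)) + (F (j.1, i.2) - F (j.1, j.2)) := by ring
      rw [this]
      nlinarith [sq_nonneg ((F (i.1, i.2) - F (j.1, i.2)) - (F (j.1, i.2) - F (j.1, j.2)))]
    linarith
  refine (Finset.sum_le_sum fun i hi => Finset.sum_le_sum fun j hj => h1 i hi j hj).trans
    (le_of_eq ?_)
  simp only [Finset.sum_add_distrib, Finset.sum_const, Finset.card_product, hXN, hYN,
    nsmul_eq_mul, ← Finset.mul_sum, Finset.sum_product, Nat.cast_mul]
  rw [Finset.sum_comm (s := Y) (t := X)]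
  ring

/-! ### Balls and energy -/

namespace SimpleGraph

variable {V : Type*} {G : SimpleGraph V}

theorem mem_metricBall (hG : G.Connected) {x y : V} {R : ℝ} :
    y ∈ G.metricBall x R ↔ (G.dist y x : ℝ) ≤ R :=
  ⟨fun h => h.2, fun h => ⟨hG.preconnected y x, h⟩⟩

/-- A connected graph all of whose balls are finite. -/
structure FiniteBalls (G : SimpleGraph V) : Prop where
  connected : G.Connected
  finite : ∀ (x : V) (R : ℝ), (G.metricBall x R).Finite

namespace FiniteBalls

variable (h : G.FiniteBalls)

/-- The ball as a finite set. -/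
noncomputable def ball (x : V) (R : ℝ) : Finset V := (h.finite x R).toFinset

theorem mem_ball {x y : V} {R : ℝ} : y ∈ h.ball x R ↔ (G.dist y x : ℝ) ≤ R := by
  rw [ball, Set.Finite.mem_toFinset, mem_metricBall h.connected]

theorem self_mem_ball {x : V} {R : ℝ} (hR : 0 ≤ R) : x ∈ h.ball x R := by
  rw [h.mem_ball, dist_self]; simpa

theorem ncard_metricBall (x : V) (R : ℝ) : (G.metricBall x R).ncard = (h.ball x R).card :=
  Set.ncard_eq_toFinset_card _ _

theorem dist_triangle (h : G.FiniteBalls) (u v w : V) : (G.dist u w : ℝ) ≤ G.dist u v + G.dist v w := by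
  exact_mod_cast h.connected.dist_triangle

theorem ball_subset {x y : V} {r R : ℝ} (hr : G.dist y x + r ≤ R) : h.ball y r ⊆ h.ball x R := by
  intro z hz
  rw [h.mem_ball] at hz ⊢
  linarith [h.dist_triangle z y x]

theorem finite_ballEdges (h : G.FiniteBalls) (x : V) (R : ℝ) : (G.ballEdges x R).Finite :=
  ((h.finite x R).prod (h.finite x R)).subset fun _ hp => ⟨hp.1, hp.2.1⟩

/-- The ordered pairs of adjacent vertices in a ball, as a finite set. -/
noncomputable def edges (x : V) (R : ℝ) : Finset (V × V) := (h.finite_ballEdges x R).toFinset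

theorem mem_edges {x : V} {R : ℝ} {p : V × V} : p ∈ h.edges x R ↔
    p.1 ∈ h.ball x R ∧ p.2 ∈ h.ball x R ∧ G.Adj p.1 p.2 := by
  rw [edges, Set.Finite.mem_toFinset, ball, Set.Finite.mem_toFinset, Set.Finite.mem_toFinset]
  rfl

theorem edges_subset {x y : V} {r R : ℝ} (hr : G.dist y x + r ≤ R) :
    h.edges y r ⊆ h.edges x R := by
  intro p hp
  rw [h.mem_edges] at hp ⊢
  exact ⟨h.ball_subset hr hp.1, h.ball_subset hr hp.2.1, hp.2.2⟩

/-- The Dirichlet energy of `f` in a ball. -/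
noncomputable def energy (f : V → ℝ) (x : V) (R : ℝ) : ℝ :=
  ∑ p ∈ h.edges x R, (f p.1 - f p.2) ^ 2

theorem energy_nonneg (f : V → ℝ) (x : V) (R : ℝ) : 0 ≤ h.energy f x R :=
  Finset.sum_nonneg fun _ _ => sq_nonneg _

theorem energy_mono (f : V → ℝ) {x y : V} {r R : ℝ} (hr : G.dist y x + r ≤ R) :
    h.energy f y r ≤ h.energy f x R :=
  Finset.sum_le_sum_of_subset_of_nonneg (h.edges_subset hr) fun _ _ _ => sq_nonneg _

/-- Telescoping and Cauchy–Schwarz along a geodesic, whose edges are distinct and stay within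
distance `n` of `a`. -/
theorem sq_sub_le_energy (f : V → ℝ) {a b : V} {n : ℕ} (hab : G.dist a b ≤ n) :
    (f a - f b) ^ 2 ≤ n * h.energy f a n := by
  classical
  obtain ⟨p, hp, hlen⟩ := h.connected.exists_path_of_dist a b
  rw [← hlen] at hab
  have h1 := Finset.sum_range_sub (fun k : ℕ => f (p.getVert k)) p.length
  simp only [Walk.getVert_length, Walk.getVert_zero] at h1
  have h2 : f a - f b = -∑ k ∈ Finset.range p.length, (f (p.getVert (k + 1)) - f (p.getVert k)) := by
    rw [h1]; ring
  rw [h2, neg_sq]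
  refine (sq_sum_le_card_mul_sum_sq (s := Finset.range p.length)).trans ?_
  rw [Finset.card_range]
  have hinj : Set.InjOn (fun k : ℕ => (p.getVert (k + 1), p.getVert k)) (Finset.range p.length) := by
    intro i hi j hj hij
    simp only [Finset.coe_range, Set.mem_Iio] at hi hj
    exact hp.getVert_injOn (by simpa using hi.le) (by simpa using hj.le) (Prod.mk.inj hij).2
  have hdist : ∀ k, k ≤ p.length → p.getVert k ∈ h.ball a n := by
    intro k hk
    rw [h.mem_ball, G.dist_comm]
    have h3 := G.dist_le (p.take k)
    rw [Walk.take_length, min_eq_left hk] at h3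
    exact_mod_cast h3.trans (hk.trans hab)
  have hsub : (Finset.range p.length).image (fun k : ℕ => (p.getVert (k + 1), p.getVert k)) ⊆
      h.edges a n := by
    intro x hx
    obtain ⟨k, hk, rfl⟩ := Finset.mem_image.1 hx
    rw [Finset.mem_range] at hk
    exact h.mem_edges.2 ⟨hdist _ hk, hdist _ hk.le, (p.adj_getVert_succ hk).symm⟩
  have hsum : ∑ k ∈ Finset.range p.length, (f (p.getVert (k + 1)) - f (p.getVert k)) ^ 2 ≤
      h.energy f a n := by
    rw [← Finset.sum_image (f := fun q : V × V => (f q.1 - f q.2) ^ 2) hinj]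
    exact Finset.sum_le_sum_of_subset_of_nonneg hsub fun _ _ _ => sq_nonneg _
  exact mul_le_mul (by exact_mod_cast hab) hsum (Finset.sum_nonneg fun _ _ => sq_nonneg _)
    (Nat.cast_nonneg _)

open Classical in
/-- Energies of balls with bounded overlap add up to at most a multiple of the total energy. -/
theorem sum_energy_le (f : V → ℝ) {ι : Type*} (I : Finset ι) (g : ι → V) {x : V} {l R M : ℝ}
    (hR : ∀ i ∈ I, G.dist (g i) x + l ≤ R)
    (hM : ∀ u : V, ((I.filter fun i => (G.dist u (g i) : ℝ) ≤ l).card : ℝ) ≤ M) :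
    ∑ i ∈ I, h.energy f (g i) l ≤ M * h.energy f x R := by
  have h1 : ∀ i ∈ I, h.energy f (g i) l =
      ∑ p ∈ h.edges x R, if p ∈ h.edges (g i) l then (f p.1 - f p.2) ^ 2 else 0 := by
    intro i hi
    rw [← Finset.sum_filter, energy]
    congr 1
    ext p
    rw [Finset.mem_filter]
    exact ⟨fun hp => ⟨h.edges_subset (hR i hi) hp, hp⟩, fun hp => hp.2⟩
  rw [Finset.sum_congr rfl h1, Finset.sum_comm, energy, Finset.mul_sum]
  refine Finset.sum_le_sum fun p _ => ?_
  rw [← Finset.sum_filter, Finset.sum_const, nsmul_eq_mul]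
  refine mul_le_mul_of_nonneg_right (le_trans ?_ (hM p.1)) (sq_nonneg _)
  exact_mod_cast Finset.card_le_card (Finset.monotone_filter_right _ fun i _ hi =>
    h.mem_ball.1 (h.mem_edges.1 hi).1)

end FiniteBalls

end SimpleGraph

/-! ### Graphs that are roughly isometric to the integer grid -/

/-- The point of the integer grid with the given coordinates. -/
noncomputable def gridPt (i : ℤ × ℤ) : ℂ := ⟨i.1, i.2⟩

/-- The lower left corner of the unit cell that contains `z`. -/
noncomputable def gridFloor (z : ℂ) : ℤ × ℤ := (⌊z.re⌋, ⌊z.im⌋)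

theorem unitSeparated_gridPt : UnitSeparated gridPt := by
  intro i j hij
  have h : i.1 ≠ j.1 ∨ i.2 ≠ j.2 := by
    by_contra hcon
    push Not at hcon
    exact hij (Prod.ext hcon.1 hcon.2)
  rcases h with h | h
  · refine le_trans ?_ (Complex.abs_re_le_norm _)
    have : (1 : ℤ) ≤ |i.1 - j.1| := Int.one_le_abs (sub_ne_zero.2 h)
    simp only [gridPt, Complex.sub_re]
    exact_mod_cast this
  · refine le_trans ?_ (Complex.abs_im_le_norm _)
    have : (1 : ℤ) ≤ |i.2 - j.2| := Int.one_le_abs (sub_ne_zero.2 h)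
    simp only [gridPt, Complex.sub_im]
    exact_mod_cast this

theorem norm_sub_gridFloor_le (z : ℂ) : ‖z - gridPt (gridFloor z)‖ ≤ 2 := by
  refine (Complex.norm_le_abs_re_add_abs_im _).trans ?_
  simp only [gridPt, gridFloor, Complex.sub_re, Complex.sub_im]
  have h1 := Int.fract_nonneg z.re
  have h2 := Int.fract_lt_one z.re
  have h3 := Int.fract_nonneg z.im
  have h4 := Int.fract_lt_one z.im
  unfold Int.fract at h1 h2 h3 h4
  rw [abs_of_nonneg h1, abs_of_nonneg h3]
  linarith

/-- The square of side `2n` around `i` in the integer grid. -/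
noncomputable def gridBox (i : ℤ × ℤ) (n : ℕ) : Finset (ℤ × ℤ) :=
  Finset.Icc (i.1 - n) (i.1 + n) ×ˢ Finset.Icc (i.2 - n) (i.2 + n)

theorem card_Icc_sub_add (a : ℤ) (n : ℕ) : (Finset.Icc (a - n) (a + n)).card = 2 * n + 1 := by
  rw [Int.card_Icc]; lia

theorem card_gridBox (i : ℤ × ℤ) (n : ℕ) : (gridBox i n).card = (2 * n + 1) ^ 2 := by
  rw [gridBox, Finset.card_product, card_Icc_sub_add, card_Icc_sub_add, sq]

theorem gridFloor_mem_gridBox {z w : ℂ} {r : ℝ} (h : ‖w - z‖ ≤ r) :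
    gridFloor w ∈ gridBox (gridFloor z) (⌊r⌋₊ + 1) := by
  have key : ∀ x y : ℝ, |x - y| ≤ r → ⌊y⌋ - ((⌊r⌋₊ + 1 : ℕ) : ℤ) ≤ ⌊x⌋ ∧
      ⌊x⌋ ≤ ⌊y⌋ + ((⌊r⌋₊ + 1 : ℕ) : ℤ) := by
    intro x y hxy
    have hxy := abs_le.1 hxy
    have a1 := Int.floor_le x
    have a2 := Int.lt_floor_add_one x
    have b1 := Int.floor_le y
    have b2 := Int.lt_floor_add_one y
    have c2 := Nat.lt_floor_add_one r
    constructor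
    · have : (⌊y⌋ : ℝ) < ⌊x⌋ + ((⌊r⌋₊ + 1 : ℕ) : ℤ) + 1 := by push_cast; linarith
      have : ⌊y⌋ < ⌊x⌋ + ((⌊r⌋₊ + 1 : ℕ) : ℤ) + 1 := by exact_mod_cast this
      lia
    · have : (⌊x⌋ : ℝ) < ⌊y⌋ + ((⌊r⌋₊ + 1 : ℕ) : ℤ) + 1 := by push_cast; linarith
      have : ⌊x⌋ < ⌊y⌋ + ((⌊r⌋₊ + 1 : ℕ) : ℤ) + 1 := by exact_mod_cast this
      lia
  have hr := (Complex.abs_re_le_norm (w - z)).trans h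
  have hi := (Complex.abs_im_le_norm (w - z)).trans h
  rw [Complex.sub_re] at hr
  rw [Complex.sub_im] at hi
  simp only [gridFloor, gridBox, Finset.mem_product, Finset.mem_Icc]
  exact ⟨key _ _ hr, key _ _ hi⟩

/-- The vertices of a graph `G` are placed at unit separated points `c v` of the plane, and `φ`
maps the integer grid to `G`; both maps are Lipschitz and, up to bounded errors, inverse to each
other. -/
structure GridApprox {V : Type*} (G : SimpleGraph V) (c : V → ℂ) (φ : ℤ × ℤ → V) (K L : ℕ) :
    Prop where
  connected : G.Connected
  separated : UnitSeparated c
  lipschitz : ∀ v w, ‖c v - c w‖ ≤ G.dist v w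
  one_le : 1 ≤ L
  norm_sub_le : ∀ i, ‖c (φ i) - gridPt i‖ ≤ K
  dist_right : ∀ i : ℤ × ℤ, G.dist (φ i) (φ (i.1 + 1, i.2)) ≤ L
  dist_up : ∀ i : ℤ × ℤ, G.dist (φ i) (φ (i.1, i.2 + 1)) ≤ L
  dist_floor : ∀ v, G.dist v (φ (gridFloor (c v))) ≤ L

namespace GridApprox

variable {V : Type*} {G : SimpleGraph V} {c : V → ℂ} {φ : ℤ × ℤ → V} {K L : ℕ}

theorem finiteBalls (h : GridApprox G c φ K L) : G.FiniteBalls where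
  connected := h.connected
  finite x R := (h.separated.finite_closedBall (c x) R).subset fun v hv =>
    (h.lipschitz v x).trans hv.2

variable (h : GridApprox G c φ K L)

theorem card_ball_le (x : V) {R : ℝ} (hR : 0 ≤ R) :
    ((h.finiteBalls.ball x R).card : ℝ) ≤ (4 * R + 3) ^ 2 :=
  h.separated.card_le (c x) hR _ fun v hv =>
    (h.lipschitz v x).trans (h.finiteBalls.mem_ball.1 hv)

theorem dist_grid_le (h : GridApprox G c φ K L) (i j : ℤ × ℤ) :
    G.dist (φ i) (φ j) ≤ L * ((i.1 - j.1).natAbs + (i.2 - j.2).natAbs) := by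
  have right : ∀ (m : ℕ) (a b : ℤ), G.dist (φ (a, b)) (φ (a + m, b)) ≤ L * m := by
    intro m a b
    induction m with
    | zero => simp
    | succ m ih =>
      have h1 := h.dist_right (a + m, b)
      have h2 := h.connected.dist_triangle (u := φ (a, b)) (v := φ (a + m, b))
        (w := φ (a + m + 1, b))
      simp only at h1
      push_cast
      rw [← add_assoc]
      lia
  have up : ∀ (m : ℕ) (a b : ℤ), G.dist (φ (a, b)) (φ (a, b + m)) ≤ L * m := by
    intro m a b
    induction m with
    | zero => simp
    | succ m ih =>
      have h1 := h.dist_up (a, b + m)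
      have h2 := h.connected.dist_triangle (u := φ (a, b)) (v := φ (a, b + m))
        (w := φ (a, b + m + 1))
      simp only at h1
      push_cast
      rw [← add_assoc]
      lia
  have right' : G.dist (φ (i.1, i.2)) (φ (j.1, i.2)) ≤ L * (i.1 - j.1).natAbs := by
    rcases le_total i.1 j.1 with hle | hle
    · have := right (i.1 - j.1).natAbs i.1 i.2
      rwa [show i.1 + ((i.1 - j.1).natAbs : ℤ) = j.1 by lia] at this
    · have := right (i.1 - j.1).natAbs j.1 i.2
      rwa [show j.1 + ((i.1 - j.1).natAbs : ℤ) = i.1 by lia, G.dist_comm] at this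
  have up' : G.dist (φ (j.1, i.2)) (φ (j.1, j.2)) ≤ L * (i.2 - j.2).natAbs := by
    rcases le_total i.2 j.2 with hle | hle
    · have := up (i.2 - j.2).natAbs j.1 i.2
      rwa [show i.2 + ((i.2 - j.2).natAbs : ℤ) = j.2 by lia] at this
    · have := up (i.2 - j.2).natAbs j.1 j.2
      rwa [show j.2 + ((i.2 - j.2).natAbs : ℤ) = i.2 by lia, G.dist_comm] at this
  have h3 := h.connected.dist_triangle (u := φ (i.1, i.2)) (v := φ (j.1, i.2)) (w := φ (j.1, j.2))
  rw [mul_add]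
  exact h3.trans (add_le_add right' up')

theorem dist_of_mem_gridBox (h : GridApprox G c φ K L) {x : V} {n : ℕ} {i : ℤ × ℤ}
    (hi : i ∈ gridBox (gridFloor (c x)) n) : (G.dist (φ i) x : ℝ) ≤ L * (2 * n + 1) := by
  have h1 := h.dist_grid_le i (gridFloor (c x))
  have h2 := h.dist_floor x
  rw [G.dist_comm] at h2
  have h3 := h.connected.dist_triangle (u := φ i) (v := φ (gridFloor (c x))) (w := x)
  simp only [gridBox, Finset.mem_product, Finset.mem_Icc] at hi
  have h4 : (i.1 - (gridFloor (c x)).1).natAbs + (i.2 - (gridFloor (c x)).2).natAbs ≤ 2 * n := by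
    lia
  have h5 : G.dist (φ i) x ≤ L * (2 * n + 1) := by
    have := Nat.mul_le_mul_left L h4
    rw [mul_add, mul_one]
    lia
  exact_mod_cast h5

/-- Balls have at least quadratic volume. -/
theorem le_card_ball (x : V) {r : ℝ} (hr : 0 ≤ r) :
    (r + 1) ^ 2 ≤ (18 * L ^ 2 * (4 * K + 3) ^ 2 + 2) * (h.finiteBalls.ball x r).card := by
  classical
  have hL : (1 : ℝ) ≤ L := by exact_mod_cast h.one_le
  have hL0 : (0 : ℝ) < L := by linarith
  set M : ℝ := (4 * K + 3) ^ 2 with hM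
  have hM1 : 1 ≤ M := by
    have : (0 : ℝ) ≤ K := Nat.cast_nonneg _
    rw [hM]; nlinarith
  have hB1 : (1 : ℝ) ≤ (h.finiteBalls.ball x r).card := by
    have : 0 < (h.finiteBalls.ball x r).card := Finset.card_pos.2 ⟨x, h.finiteBalls.self_mem_ball hr⟩
    exact_mod_cast this
  have key : r ^ 2 ≤ 9 * L ^ 2 * M * (h.finiteBalls.ball x r).card := by
    rcases lt_or_ge r L with hlt | hge
    · have h1 : r ^ 2 ≤ L ^ 2 := by nlinarith
      have h2 : (L : ℝ) ^ 2 * 1 ≤ L ^ 2 * (9 * (M * (h.finiteBalls.ball x r).card)) := by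
        refine mul_le_mul_of_nonneg_left ?_ (sq_nonneg _)
        nlinarith
      nlinarith
    -- The largest box whose image is sure to lie in the ball, that is, `L * (2 * m + 1) ≤ r`.
    · set m : ℕ := ⌊(r / L - 1) / 2⌋₊ with hm
      have hrL : 1 ≤ r / L := by rwa [le_div_iff₀ hL0, one_mul]
      have hm1 : (m : ℝ) ≤ (r / L - 1) / 2 := Nat.floor_le (by linarith)
      have hm2 : (r / L - 1) / 2 < m + 1 := Nat.lt_floor_add_one _
      have hm0 : (0 : ℝ) ≤ m := Nat.cast_nonneg _
      have hsub : (gridBox (gridFloor (c x)) m).image φ ⊆ h.finiteBalls.ball x r := by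
        intro v hv
        obtain ⟨i, hi, rfl⟩ := Finset.mem_image.1 hv
        rw [h.finiteBalls.mem_ball]
        refine (h.dist_of_mem_gridBox hi).trans ?_
        have : 2 * (m : ℝ) + 1 ≤ r / L := by linarith
        rw [le_div_iff₀ hL0] at this
        linarith
      -- The preimages of `v` under `φ` are grid points within `K` of `c v`, which bounds their
      -- number.
      have hcard : (gridBox (gridFloor (c x)) m).card ≤
          (4 * K + 3) ^ 2 * ((gridBox (gridFloor (c x)) m).image φ).card := by
        refine Finset.card_le_mul_card_image _ _ fun v _ => ?_
        have h1 := unitSeparated_gridPt.card_le (c v) (r := K) (Nat.cast_nonneg _)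
          ((gridBox (gridFloor (c x)) m).filter fun i => φ i = v) (by
            intro i hi
            rw [← (Finset.mem_filter.1 hi).2, norm_sub_rev]
            exact h.norm_sub_le i)
        exact_mod_cast h1
      rw [card_gridBox] at hcard
      have hcard' : (2 * (m : ℝ) + 1) ^ 2 ≤ M * (h.finiteBalls.ball x r).card := by
        have h1 : (((2 * m + 1) ^ 2 : ℕ) : ℝ) ≤ (((4 * K + 3) ^ 2 *
          ((gridBox (gridFloor (c x)) m).image φ).card : ℕ) : ℝ) := by exact_mod_cast hcard
        push_cast at h1
        refine h1.trans ?_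
        refine mul_le_mul_of_nonneg_left ?_ (by linarith)
        exact_mod_cast Finset.card_le_card hsub
      have h3 : r / L ≤ 3 * (2 * m + 1) := by
        rcases le_total (r / L) 3 with h4 | h4 <;> linarith
      have h4 : r ≤ 3 * (2 * m + 1) * L := by rwa [div_le_iff₀ hL0] at h3
      have h5 : r ^ 2 ≤ (3 * (2 * m + 1) * L) ^ 2 := by gcongr
      calc r ^ 2 ≤ (3 * (2 * m + 1) * L) ^ 2 := h5
        _ = 9 * L ^ 2 * (2 * m + 1) ^ 2 := by ring
        _ ≤ 9 * L ^ 2 * (M * (h.finiteBalls.ball x r).card) := by gcongr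
        _ = _ := by ring
  have h1 : (r + 1) ^ 2 ≤ 2 * r ^ 2 + 2 := by nlinarith [sq_nonneg (r - 1)]
  calc (r + 1) ^ 2 ≤ 2 * r ^ 2 + 2 := h1
    _ ≤ 2 * (9 * L ^ 2 * M * (h.finiteBalls.ball x r).card) +
        2 * (h.finiteBalls.ball x r).card := by linarith
    _ = _ := by ring

theorem volumeDoublingWith (h : GridApprox G c φ K L) :
    G.VolumeDoublingWith (64 * (18 * L ^ 2 * (4 * K + 3) ^ 2 + 2)) := by
  intro x R hR
  refine ⟨h.finiteBalls.finite _ _, ?_⟩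
  rw [h.finiteBalls.ncard_metricBall, h.finiteBalls.ncard_metricBall]
  have h1 := h.card_ball_le x (R := 2 * R) (by linarith)
  have h2 := h.le_card_ball x hR.le
  calc ((h.finiteBalls.ball x (2 * R)).card : ℝ) ≤ (4 * (2 * R) + 3) ^ 2 := h1
    _ ≤ 64 * (R + 1) ^ 2 := by nlinarith
    _ ≤ _ := by rw [mul_assoc]; gcongr

/-! ### A Poincaré inequality with a larger ball on the right -/

-- A unit cell contains at most `(4 * 2 + 3) ^ 2 = 121` vertices, since all of them lie within 2 of
-- its corner.
open Classical in
theorem sum_comp_gridFloor_le {s : Finset V} {B : Finset (ℤ × ℤ)} (hc : UnitSeparated c)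
    (hs : ∀ y ∈ s, gridFloor (c y) ∈ B) {g : ℤ × ℤ → ℝ} (hg : ∀ i, 0 ≤ g i) :
    ∑ y ∈ s, g (gridFloor (c y)) ≤ 121 * ∑ i ∈ B, g i := by
  rw [← Finset.sum_fiberwise_of_maps_to hs, Finset.mul_sum]
  refine Finset.sum_le_sum fun i _ => ?_
  rw [Finset.sum_congr rfl fun y hy => by rw [(Finset.mem_filter.1 hy).2], Finset.sum_const,
    nsmul_eq_mul]
  refine mul_le_mul_of_nonneg_right ?_ (hg i)
  have h1 := hc.card_le (gridPt i) (r := 2) (by norm_num)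
    (s.filter fun y => gridFloor (c y) = i) (by
      intro y hy
      rw [← (Finset.mem_filter.1 hy).2]
      exact norm_sub_gridFloor_le _)
  norm_num at h1
  exact_mod_cast h1

/-- The differences of `f` along the grid are controlled by the energy. -/
theorem sum_grid_steps_le (f : V → ℝ) (x : V) (n : ℕ) :
    ∑ i ∈ gridBox (gridFloor (c x)) n, ((f (φ (i.1 + 1, i.2)) - f (φ i)) ^ 2 +
      (f (φ (i.1, i.2 + 1)) - f (φ i)) ^ 2) ≤
      2 * L * (4 * (K + L) + 3) ^ 2 * h.finiteBalls.energy f x (L * (2 * n + 2)) := by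
  classical
  have h1 : ∀ i : ℤ × ℤ, (f (φ (i.1 + 1, i.2)) - f (φ i)) ^ 2 +
      (f (φ (i.1, i.2 + 1)) - f (φ i)) ^ 2 ≤ 2 * L * h.finiteBalls.energy f (φ i) L := by
    intro i
    have e1 := h.finiteBalls.sq_sub_le_energy f (h.dist_right i)
    have e2 := h.finiteBalls.sq_sub_le_energy f (h.dist_up i)
    rw [← neg_sub, neg_sq] at e1 e2
    linarith
  refine (Finset.sum_le_sum fun i _ => h1 i).trans ?_
  rw [← Finset.mul_sum, mul_assoc (2 * (L : ℝ))]
  refine mul_le_mul_of_nonneg_left ?_ (by positivity)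
  refine h.finiteBalls.sum_energy_le f _ φ ?_ ?_
  · intro i hi
    have := h.dist_of_mem_gridBox hi
    linarith
  · intro u
    refine unitSeparated_gridPt.card_le (c u) (by positivity) _ fun i hi => ?_
    have h2 := (Finset.mem_filter.1 hi).2
    have h3 := h.lipschitz u (φ i)
    have h4 := h.norm_sub_le i
    rw [norm_sub_rev] at h3 h4
    linarith [norm_sub_le_norm_sub_add_norm_sub (gridPt i) (c (φ i)) (c u)]

/-- The passage from `f` to its values on the grid is controlled by the energy. -/
theorem sum_sq_sub_floor_le (f : V → ℝ) (x : V) (r : ℝ) :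
    ∑ y ∈ h.finiteBalls.ball x r, (f y - f (φ (gridFloor (c y)))) ^ 2 ≤
      L * (4 * L + 3) ^ 2 * h.finiteBalls.energy f x (r + L) := by
  classical
  refine (Finset.sum_le_sum fun y _ =>
    h.finiteBalls.sq_sub_le_energy f (h.dist_floor y)).trans ?_
  rw [← Finset.mul_sum, mul_assoc]
  refine mul_le_mul_of_nonneg_left ?_ (Nat.cast_nonneg _)
  refine h.finiteBalls.sum_energy_le f _ _ ?_ ?_
  · intro y hy
    have := h.finiteBalls.mem_ball.1 hy
    linarith
  · intro u
    refine h.separated.card_le (c u) (Nat.cast_nonneg _) _ fun y hy => ?_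
    rw [norm_sub_rev]
    exact (h.lipschitz u y).trans (Finset.mem_filter.1 hy).2

/-- Passing from `f` to its samples `F` on the grid costs a bounded multiple of the energy, and the
grid inequality handles `F`. In `r ^ 4`, two powers come from the Poincaré scaling and two from the
volume, as the left side is a sum over pairs. -/
theorem exists_weak_poincare (K L : ℕ) : ∃ C : ℝ, 0 < C ∧ ∀ {V : Type*} {G : SimpleGraph V}
    {c : V → ℂ} {φ : ℤ × ℤ → V} (h : GridApprox G c φ K L) (f : V → ℝ) (x : V) {r : ℝ}, 1 ≤ r →
    ∑ y ∈ h.finiteBalls.ball x r, ∑ z ∈ h.finiteBalls.ball x r, (f y - f z) ^ 2 ≤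
      C * r ^ 4 * h.finiteBalls.energy f x (6 * L * r) := by
  refine ⟨6 * 49 * (L * (4 * L + 3) ^ 2) +
    3 * 121 ^ 2 * (2 * 5 ^ 4 * (2 * L * (4 * (K + L) + 3) ^ 2)) + 1, by positivity, ?_⟩
  intro V G c φ h f x r hr
  have hL : (1 : ℝ) ≤ L := by exact_mod_cast h.one_le
  set B := h.finiteBalls.ball x r with hB
  set E := h.finiteBalls.energy f x (6 * L * r) with hE
  have hE0 : 0 ≤ E := h.finiteBalls.energy_nonneg _ _ _
  set n : ℕ := ⌊r⌋₊ + 1 with hn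
  have hnr : (n : ℝ) ≤ r + 1 := by
    rw [hn]; push_cast; linarith [Nat.floor_le (by linarith : 0 ≤ r)]
  set F : ℤ × ℤ → ℝ := fun i => f (φ i) with hF
  set Q := gridBox (gridFloor (c x)) n with hQ
  have hfl : ∀ y ∈ B, gridFloor (c y) ∈ Q := fun y hy =>
    gridFloor_mem_gridBox ((h.lipschitz y x).trans (h.finiteBalls.mem_ball.1 hy))
  have hBc : (B.card : ℝ) ≤ 49 * r ^ 2 := by
    refine (h.card_ball_le x (by linarith : 0 ≤ r)).trans ?_
    nlinarith
  have s1 : ∑ y ∈ B, (f y - F (gridFloor (c y))) ^ 2 ≤ L * (4 * L + 3) ^ 2 * E := by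
    refine (h.sum_sq_sub_floor_le f x r).trans ?_
    refine mul_le_mul_of_nonneg_left ?_ (by positivity)
    refine h.finiteBalls.energy_mono f ?_
    rw [SimpleGraph.dist_self, Nat.cast_zero]
    nlinarith
  have s2 : ∑ y ∈ B, ∑ z ∈ B, (F (gridFloor (c y)) - F (gridFloor (c z))) ^ 2 ≤
      121 ^ 2 * ∑ i ∈ Q, ∑ j ∈ Q, (F i - F j) ^ 2 := by
    have e1 : ∀ y ∈ B, ∑ z ∈ B, (F (gridFloor (c y)) - F (gridFloor (c z))) ^ 2 ≤
        121 * ∑ j ∈ Q, (F (gridFloor (c y)) - F j) ^ 2 := fun y _ =>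
      sum_comp_gridFloor_le h.separated hfl (g := fun j => (F (gridFloor (c y)) - F j) ^ 2)
        fun _ => sq_nonneg _
    refine (Finset.sum_le_sum e1).trans ?_
    rw [← Finset.mul_sum, sq, mul_assoc]
    refine mul_le_mul_of_nonneg_left ?_ (by norm_num)
    exact sum_comp_gridFloor_le h.separated hfl (g := fun i => ∑ j ∈ Q, (F i - F j) ^ 2)
      fun _ => Finset.sum_nonneg fun _ _ => sq_nonneg _
  have s3 : ∑ i ∈ Q, ∑ j ∈ Q, (F i - F j) ^ 2 ≤
      2 * 5 ^ 4 * (2 * L * (4 * (K + L) + 3) ^ 2) * r ^ 4 * E := by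
    refine (sum_sq_sub_le_grid F (N := 2 * n + 1) rfl rfl (card_Icc_sub_add _ _)
      (card_Icc_sub_add _ _)).trans ?_
    have e1 := h.sum_grid_steps_le f x n
    -- Here `2 * n + 2 ≤ 2 * r + 4 ≤ 6 * r` because `r ≥ 1`; this is the origin of the factor `6 *
    -- L`.
    have e2 : h.finiteBalls.energy f x (L * (2 * n + 2)) ≤ E := by
      refine h.finiteBalls.energy_mono f ?_
      rw [SimpleGraph.dist_self, Nat.cast_zero]
      nlinarith
    have e3 : ((2 * n + 1 : ℕ) : ℝ) ≤ 5 * r := by push_cast; linarith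
    have e4 : ((2 * n + 1 : ℕ) : ℝ) ^ 4 ≤ (5 * r) ^ 4 := by gcongr
    calc _ ≤ 2 * (5 * r) ^ 4 * (2 * L * (4 * (K + L) + 3) ^ 2 * E) := by
          refine mul_le_mul (by linarith) (e1.trans ?_)
            (Finset.sum_nonneg fun _ _ => add_nonneg (sq_nonneg _) (sq_nonneg _)) (by positivity)
          exact mul_le_mul_of_nonneg_left e2 (by positivity)
      _ = _ := by ring
  have s4 : ∑ y ∈ B, ∑ z ∈ B, (f y - f z) ^ 2 ≤
      6 * B.card * ∑ y ∈ B, (f y - F (gridFloor (c y))) ^ 2 +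
      3 * ∑ y ∈ B, ∑ z ∈ B, (F (gridFloor (c y)) - F (gridFloor (c z))) ^ 2 := by
    have e1 : ∀ y z : V, (f y - f z) ^ 2 ≤ 3 * (f y - F (gridFloor (c y))) ^ 2 +
        3 * (f z - F (gridFloor (c z))) ^ 2 +
        3 * (F (gridFloor (c y)) - F (gridFloor (c z))) ^ 2 := by
      intro y z
      set p := f y - F (gridFloor (c y)) with hp
      set q := f z - F (gridFloor (c z)) with hq
      set w := F (gridFloor (c y)) - F (gridFloor (c z)) with hw
      have : f y - f z = p + w - q := by rw [hp, hq, hw]; ring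
      rw [this]
      nlinarith [sq_nonneg (p - w), sq_nonneg (p + q), sq_nonneg (w + q)]
    refine (Finset.sum_le_sum fun y _ => Finset.sum_le_sum fun z _ => e1 y z).trans (le_of_eq ?_)
    simp only [Finset.sum_add_distrib, Finset.sum_const, nsmul_eq_mul, ← Finset.mul_sum]
    ring
  have hr4 : r ^ 2 ≤ r ^ 4 := pow_le_pow_right₀ hr (by norm_num)
  have t1 : 6 * B.card * ∑ y ∈ B, (f y - F (gridFloor (c y))) ^ 2 ≤
      6 * (49 * r ^ 4) * (L * (4 * L + 3) ^ 2 * E) := by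
    refine mul_le_mul (by linarith) s1 (Finset.sum_nonneg fun _ _ => sq_nonneg _) (by positivity)
  have t2 := s2.trans (mul_le_mul_of_nonneg_left s3 (by norm_num))
  have t3 : 0 ≤ r ^ 4 * E := by positivity
  calc _ ≤ _ := s4
    _ ≤ 6 * (49 * r ^ 4) * (L * (4 * L + 3) ^ 2 * E) +
        3 * (121 ^ 2 * (2 * 5 ^ 4 * (2 * L * (4 * (K + L) + 3) ^ 2) * r ^ 4 * E)) := by linarith
    _ ≤ _ := by linarith

end GridApprox

/-! ### The Poincaré inequality -/

section Average

variable {ι : Type*}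

/-- The average of `f` over a finite set. -/
noncomputable def average (s : Finset ι) (f : ι → ℝ) : ℝ := (∑ u ∈ s, f u) / s.card

theorem sq_sub_average_le {s : Finset ι} (hs : 0 < s.card) (f : ι → ℝ) (a : ℝ) :
    (a - average s f) ^ 2 ≤ (∑ u ∈ s, (a - f u) ^ 2) / s.card := by
  have h0 : (0 : ℝ) < s.card := by exact_mod_cast hs
  have h1 : a - average s f = (∑ u ∈ s, (a - f u)) / s.card := by
    rw [average, Finset.sum_sub_distrib, Finset.sum_const, nsmul_eq_mul]
    field_simp
  rw [h1, div_pow, div_le_div_iff₀ (by positivity) h0]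
  have h2 := sq_sum_le_card_mul_sum_sq (s := s) (f := fun u => a - f u)
  nlinarith

theorem sq_average_sub_average_le {s t : Finset ι} (hs : 0 < s.card) (ht : 0 < t.card)
    (f : ι → ℝ) : (average s f - average t f) ^ 2 ≤
      (∑ u ∈ s, ∑ w ∈ t, (f u - f w) ^ 2) / (s.card * t.card) := by
  have h0 : (0 : ℝ) < s.card := by exact_mod_cast hs
  have h1 := sq_sub_average_le hs f (average t f)
  rw [← neg_sub, neg_sq] at h1
  refine h1.trans ?_
  rw [mul_comm, ← div_div]
  refine div_le_div_of_nonneg_right ?_ h0.le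
  rw [Finset.sum_div]
  refine Finset.sum_le_sum fun u _ => ?_
  have h2 := sq_sub_average_le ht f (f u)
  rwa [← neg_sub, neg_sq] at h2

/-- The average minimises the sum of squared deviations, so any convenient constant may replace it.
-/
theorem sum_sq_sub_average_le (s : Finset ι) (f : ι → ℝ) (a : ℝ) :
    ∑ u ∈ s, (f u - average s f) ^ 2 ≤ ∑ u ∈ s, (f u - a) ^ 2 := by
  rcases s.card.eq_zero_or_pos with h | h
  · rw [Finset.card_eq_zero.1 h]; simp
  have h0 : (0 : ℝ) < s.card := by exact_mod_cast h
  have h1 : ∑ u ∈ s, f u = s.card * average s f := by rw [average]; field_simp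
  have h2 : ∑ u ∈ s, (f u - a) ^ 2 = ∑ u ∈ s, (f u - average s f) ^ 2 +
      s.card * (average s f - a) ^ 2 := by
    have e : ∀ u, (f u - a) ^ 2 = (f u - average s f) ^ 2 +
        2 * (average s f - a) * f u + (a ^ 2 - average s f ^ 2) := fun u => by ring
    simp only [e, Finset.sum_add_distrib, Finset.sum_const, nsmul_eq_mul, ← Finset.mul_sum, h1]
    ring
  rw [h2]
  have : 0 ≤ s.card * (average s f - a) ^ 2 := by positivity
  linarith

end Average

namespace SimpleGraph

variable {V : Type*} {G : SimpleGraph V}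

theorem Connected.exists_toward (hG : G.Connected) (y x : V) (s : ℕ) :
    ∃ z, G.dist y z ≤ s ∧ G.dist z x ≤ G.dist y x - s := by
  obtain ⟨p, hp⟩ := hG.exists_walk_length_eq_dist y x
  refine ⟨p.getVert s, ?_, ?_⟩
  · refine (G.dist_le (p.take s)).trans ?_
    rw [Walk.take_length]
    exact min_le_left _ _
  · refine (G.dist_le (p.drop s)).trans ?_
    rw [Walk.drop_length, hp]

theorem Connected.abs_sub_le_of_steps (hG : G.Connected) {A : V → ℝ} {x : V} {s N : ℕ} {Q : ℝ}
    (hQ : ∀ z z', G.dist z x ≤ N → G.dist z z' ≤ s → |A z - A z'| ≤ Q) (J : ℕ) {y : V}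
    (hy : G.dist y x ≤ N) (hJ : G.dist y x ≤ J * s) : |A y - A x| ≤ J * Q := by
  induction J generalizing y with
  | zero =>
    have h1 : y = x := by
      rw [zero_mul, Nat.le_zero] at hJ
      exact hG.dist_eq_zero_iff.1 hJ
    simp [h1]
  | succ J ih =>
    obtain ⟨z, hz1, hz2⟩ := hG.exists_toward y x s
    have h1 := ih (y := z) (by lia) (by rw [add_mul, one_mul] at hJ; lia)
    have h2 := hQ y z hy hz1
    push_cast
    linarith [abs_sub_le (A y) (A z) (A x)]

namespace FiniteBalls

variable (h : G.FiniteBalls)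

-- The factor `(h.ball y r).card` is a sum over auxiliary centres `w` within `r` of `y`. Both `y`
-- and `u` lie in the ball of radius `2 * r` around `w`, so pair inequalities on such balls apply
-- without a covering argument.
open Classical in
theorem card_mul_sum_le (T : V → V → ℝ) (hT : ∀ y u, 0 ≤ T y u) (x : V) (R r : ℝ) :
    ∑ y ∈ h.ball x R, (h.ball y r).card * ∑ u ∈ h.ball y r, T y u ≤
      ∑ w ∈ h.ball x (R + r), ∑ y ∈ h.ball w (2 * r), ∑ u ∈ h.ball w (2 * r), T y u := by
  have h1 : ∀ y ∈ h.ball x R, (h.ball y r).card * ∑ u ∈ h.ball y r, T y u =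
      ∑ w ∈ h.ball y r, ∑ u ∈ h.ball y r, T y u := by
    intro y _
    rw [Finset.sum_const, nsmul_eq_mul]
  rw [Finset.sum_congr rfl h1]
  rw [Finset.sum_comm' (t' := h.ball x (R + r))
    (s' := fun w => (h.ball x R).filter fun y => w ∈ h.ball y r)]
  · refine Finset.sum_le_sum fun w _ => ?_
    refine (Finset.sum_le_sum (f := fun y => ∑ u ∈ h.ball y r, T y u)
      (g := fun y => ∑ u ∈ h.ball w (2 * r), T y u) fun y hy => ?_).trans ?_
    · have hw := h.mem_ball.1 (Finset.mem_filter.1 hy).2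
      rw [G.dist_comm] at hw
      exact Finset.sum_le_sum_of_subset_of_nonneg (h.ball_subset (by linarith)) fun _ _ _ => hT _ _
    · refine Finset.sum_le_sum_of_subset_of_nonneg ?_ fun _ _ _ =>
        Finset.sum_nonneg fun _ _ => hT _ _
      intro y hy
      have hw := h.mem_ball.1 (Finset.mem_filter.1 hy).2
      rw [h.mem_ball, G.dist_comm]
      have h0 : (0 : ℝ) ≤ G.dist w y := Nat.cast_nonneg _
      linarith
  · intro y w
    rw [Finset.mem_filter]
    refine ⟨fun ⟨hy, hw⟩ => ⟨⟨hy, hw⟩, ?_⟩, fun ⟨hy, _⟩ => hy⟩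
    rw [h.mem_ball] at hy hw ⊢
    linarith [h.dist_triangle w y x]

end FiniteBalls

end SimpleGraph

namespace GridApprox

theorem poincare_of_lt {V : Type*} {G : SimpleGraph V} {c : V → ℂ} {φ : ℤ × ℤ → V} {K L : ℕ}
    (h : GridApprox G c φ K L) (f : V → ℝ) (x : V) {R R₁ : ℝ} (hR : 0 ≤ R) (hR₁ : R ≤ R₁) :
    ∑ y ∈ h.finiteBalls.ball x R, (f y - f x) ^ 2 ≤
      (4 * R₁ + 3) ^ 2 * R ^ 2 * h.finiteBalls.energy f x (2 * R) := by
  set E := h.finiteBalls.energy f x (2 * R) with hE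
  have hE0 : 0 ≤ E := h.finiteBalls.energy_nonneg _ _ _
  have h1 : ∀ y ∈ h.finiteBalls.ball x R, (f y - f x) ^ 2 ≤ R ^ 2 * E := by
    intro y hy
    have hy := h.finiteBalls.mem_ball.1 hy
    rw [SimpleGraph.dist_comm] at hy
    have e1 := h.finiteBalls.sq_sub_le_energy f (le_refl (G.dist x y))
    rw [← neg_sub, neg_sq] at e1
    refine e1.trans ?_
    -- The distance is a natural number, which gives the factor `R ^ 2` even for `R < 1`.
    have e2 : (G.dist x y : ℝ) ≤ (G.dist x y : ℝ) ^ 2 := by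
      have : G.dist x y ≤ G.dist x y ^ 2 := Nat.le_self_pow (by norm_num) _
      exact_mod_cast this
    have e3 : (G.dist x y : ℝ) ^ 2 ≤ R ^ 2 := by gcongr
    refine mul_le_mul (e2.trans e3) (h.finiteBalls.energy_mono f ?_)
      (h.finiteBalls.energy_nonneg _ _ _) (sq_nonneg _)
    rw [SimpleGraph.dist_self, Nat.cast_zero]
    linarith
  refine (Finset.sum_le_card_nsmul _ _ _ h1).trans ?_
  rw [nsmul_eq_mul, mul_assoc]
  refine mul_le_mul_of_nonneg_right ((h.card_ball_le x hR).trans ?_) (by positivity)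
  gcongr

-- For large `R`, with `A` the average over balls of radius `r`, the deviation `f y - A x` splits
-- into `f y - A y` and `A y - A x`. The first part is summed over small balls, the second over a
-- bounded number of steps towards `x`. In dimension two, neighbouring averages differ by at most a
-- multiple of `√E`, without a power of `r`. Hence every local energy may be bounded by the total
-- energy `E`, and the factor `R ^ 2` is just the number of vertices.
set_option maxHeartbeats 1000000 in
theorem exists_poincare (K L : ℕ) : ∃ C : ℝ, 0 < C ∧ ∀ {V : Type*} {G : SimpleGraph V}
    {c : V → ℂ} {φ : ℤ × ℤ → V}, GridApprox G c φ K L → G.PoincareWith C := by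
  obtain ⟨Cw, hCw, hweak⟩ := exists_weak_poincare K L
  set Cv : ℝ := 18 * L ^ 2 * (4 * K + 3) ^ 2 + 2 with hCv
  have hCv0 : 0 < Cv := by positivity
  set Ca : ℝ := 16 * Cv ^ 2 * Cw with hCa
  have hCa0 : 0 < Ca := by positivity
  refine ⟨(4 * (24 * L) + 3) ^ 2 + (2 * (1936 * Cv ^ 2 * Cw) + 2 * (49 * ((48 * L) ^ 2 * Ca))),
    by positivity, ?_⟩
  intro V G c φ h x R hR
  refine ⟨h.finiteBalls.finite _ _, fun f => ?_⟩
  have hmean : G.ballMean x R f = average (h.finiteBalls.ball x R) f := by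
    rw [SimpleGraph.ballMean, average, h.finiteBalls.ncard_metricBall,
      finsum_mem_eq_finite_toFinset_sum _ (h.finiteBalls.finite x R)]
    rfl
  have hlhs : ∑ᶠ y ∈ G.metricBall x R, |f y - G.ballMean x R f| ^ 2 =
      ∑ y ∈ h.finiteBalls.ball x R, (f y - average (h.finiteBalls.ball x R) f) ^ 2 := by
    rw [finsum_mem_eq_finite_toFinset_sum _ (h.finiteBalls.finite x R), hmean]
    simp only [sq_abs]
    rfl
  have hrhs : ∑ᶠ p ∈ G.ballEdges x (2 * R), |f p.1 - f p.2| ^ 2 =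
      h.finiteBalls.energy f x (2 * R) := by
    rw [finsum_mem_eq_finite_toFinset_sum _ (h.finiteBalls.finite_ballEdges x (2 * R))]
    simp only [sq_abs]
    rfl
  rw [hlhs, hrhs]
  set E := h.finiteBalls.energy f x (2 * R) with hE
  have hE0 : 0 ≤ E := h.finiteBalls.energy_nonneg _ _ _
  have hL : (1 : ℝ) ≤ L := by exact_mod_cast h.one_le
  rcases le_total R (24 * L) with hsmall | hlarge
  · refine (sum_sq_sub_average_le _ f (f x)).trans ((h.poincare_of_lt f x hR.le hsmall).trans ?_)
    refine mul_le_mul_of_nonneg_right (mul_le_mul_of_nonneg_right ?_ (sq_nonneg _)) hE0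
    have : 0 ≤ 2 * (1936 * Cv ^ 2 * Cw) + 2 * (49 * ((48 * L) ^ 2 * Ca)) := by positivity
    linarith
  -- At radius `2 * r` the enlarged ball has radius `12 * L * r = R / 2`. Around a centre within `R
  -- + r` of `x` it stays inside the ball of radius `2 * R`.
  set r : ℝ := R / (24 * L) with hr
  have hRr : R = 24 * L * r := by rw [hr]; field_simp
  have hr1 : 1 ≤ r := by rw [hr, le_div_iff₀ (by linarith)]; linarith
  have hr0 : 0 < r := by linarith
  have hrR : 24 * r ≤ R := by rw [hRr]; nlinarith
  let A : V → ℝ := fun z => average (h.finiteBalls.ball z r) f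
  have hcard : ∀ z : V, r ^ 2 / Cv ≤ (h.finiteBalls.ball z r).card := by
    intro z
    rw [div_le_iff₀ hCv0, mul_comm]
    refine le_trans ?_ (h.le_card_ball z hr0.le)
    nlinarith
  have hcard0 : ∀ z : V, 0 < (h.finiteBalls.ball z r).card := fun z =>
    Finset.card_pos.2 ⟨z, h.finiteBalls.self_mem_ball hr0.le⟩
  have hrv : 0 < r ^ 2 / Cv := by positivity
  have hweak2 : ∀ w : V, (G.dist w x : ℝ) ≤ R + r →
      ∑ y ∈ h.finiteBalls.ball w (2 * r), ∑ u ∈ h.finiteBalls.ball w (2 * r), (f y - f u) ^ 2 ≤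
        Cw * (2 * r) ^ 4 * E := by
    intro w hw
    refine (hweak h f w (by linarith)).trans ?_
    refine mul_le_mul_of_nonneg_left (h.finiteBalls.energy_mono f ?_) (by positivity)
    have : 6 * L * (2 * r) = R / 2 := by rw [hRr]; ring
    rw [this]
    linarith
  have hstep : ∀ z z' : V, (G.dist z x : ℝ) ≤ R → (G.dist z z' : ℝ) ≤ r →
      (A z - A z') ^ 2 ≤ Ca * E := by
    intro z z' hz hzz'
    refine (sq_average_sub_average_le (hcard0 z) (hcard0 z') f).trans ?_
    have e1 : ∑ u ∈ h.finiteBalls.ball z r, ∑ w ∈ h.finiteBalls.ball z' r, (f u - f w) ^ 2 ≤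
        Cw * (2 * r) ^ 4 * E := by
      refine le_trans ?_ (hweak2 z (by linarith))
      refine (Finset.sum_le_sum fun u _ => Finset.sum_le_sum_of_subset_of_nonneg
        (h.finiteBalls.ball_subset (R := 2 * r) (x := z) ?_) fun _ _ _ => sq_nonneg _).trans ?_
      · rw [SimpleGraph.dist_comm]; linarith
      · refine Finset.sum_le_sum_of_subset_of_nonneg (h.finiteBalls.ball_subset ?_)
          fun _ _ _ => Finset.sum_nonneg fun _ _ => sq_nonneg _
        rw [SimpleGraph.dist_self, Nat.cast_zero]; linarith
    have e2 : (r ^ 2 / Cv) * (r ^ 2 / Cv) ≤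
        ((h.finiteBalls.ball z r).card : ℝ) * (h.finiteBalls.ball z' r).card :=
      mul_le_mul (hcard z) (hcard z') hrv.le (Nat.cast_nonneg _)
    refine (div_le_div₀ (by positivity) e1 (by positivity) e2).trans (le_of_eq ?_)
    rw [hCa]
    field_simp
    ring
  set s : ℕ := ⌊r⌋₊ with hs
  have hs1 : (s : ℝ) ≤ r := Nat.floor_le hr0.le
  have hs2 : r ≤ 2 * s := by
    have e1 : r < s + 1 := Nat.lt_floor_add_one r
    have e2 : 1 ≤ s := Nat.le_floor (by exact_mod_cast hr1)
    have e3 : (1 : ℝ) ≤ s := by exact_mod_cast e2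
    linarith
  have hchain : ∀ y ∈ h.finiteBalls.ball x R, (A y - A x) ^ 2 ≤ (48 * L) ^ 2 * Ca * E := by
    intro y hy
    have hy := h.finiteBalls.mem_ball.1 hy
    -- The number of steps comes from `R = 24 * L * r ≤ 48 * L * s`.
    have e1 : |A y - A x| ≤ ((48 * L : ℕ) : ℝ) * √(Ca * E) := by
      refine h.connected.abs_sub_le_of_steps (N := ⌊R⌋₊) (s := s) ?_ (48 * L) (Nat.le_floor hy) ?_
      · intro z z' hz hzz'
        refine Real.abs_le_sqrt (hstep z z' ?_ ?_)
        · exact (Nat.le_floor_iff hR.le).1 hz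
        · exact le_trans (by exact_mod_cast hzz') hs1
      · have : (G.dist y x : ℝ) ≤ ((48 * L * s : ℕ) : ℝ) := by
          push_cast
          nlinarith
        exact_mod_cast this
    have e2 : |A y - A x| ^ 2 ≤ (((48 * L : ℕ) : ℝ) * √(Ca * E)) ^ 2 := by gcongr
    rw [sq_abs, mul_pow, Real.sq_sqrt (by positivity)] at e2
    push_cast at e2
    linarith
  have hcardR : ((h.finiteBalls.ball x R).card : ℝ) ≤ 49 * R ^ 2 := by
    refine (h.card_ball_le x hR.le).trans ?_
    nlinarith
  have hfar : ∑ y ∈ h.finiteBalls.ball x R, (A y - A x) ^ 2 ≤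
      49 * R ^ 2 * ((48 * L) ^ 2 * Ca * E) := by
    refine (Finset.sum_le_card_nsmul _ _ _ hchain).trans ?_
    rw [nsmul_eq_mul]
    exact mul_le_mul_of_nonneg_right hcardR (by positivity)
  have hnear : ∑ y ∈ h.finiteBalls.ball x R, (f y - A y) ^ 2 ≤ 1936 * Cv ^ 2 * Cw * R ^ 2 * E := by
    have e1 : ∀ y ∈ h.finiteBalls.ball x R, (f y - A y) ^ 2 ≤
        ((h.finiteBalls.ball y r).card * ∑ u ∈ h.finiteBalls.ball y r, (f y - f u) ^ 2) /
          (r ^ 2 / Cv) ^ 2 := by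
      intro y _
      refine (sq_sub_average_le (hcard0 y) f (f y)).trans ?_
      have hc0 : (0 : ℝ) < (h.finiteBalls.ball y r).card := by exact_mod_cast hcard0 y
      have hsum : 0 ≤ ∑ u ∈ h.finiteBalls.ball y r, (f y - f u) ^ 2 :=
        Finset.sum_nonneg fun _ _ => sq_nonneg _
      rw [div_le_div_iff₀ hc0 (by positivity)]
      have e2 : (r ^ 2 / Cv) ^ 2 ≤ ((h.finiteBalls.ball y r).card : ℝ) ^ 2 := by
        have := hcard y
        gcongr
      nlinarith
    refine (Finset.sum_le_sum e1).trans ?_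
    rw [← Finset.sum_div, div_le_iff₀ (by positivity)]
    refine (h.finiteBalls.card_mul_sum_le (fun y u => (f y - f u) ^ 2) (fun _ _ => sq_nonneg _)
      x R r).trans ?_
    refine (Finset.sum_le_card_nsmul _ _ (Cw * (2 * r) ^ 4 * E) fun w hw =>
      hweak2 w (h.finiteBalls.mem_ball.1 hw)).trans ?_
    have e3 : ((h.finiteBalls.ball x (R + r)).card : ℝ) ≤ 121 * R ^ 2 := by
      refine (h.card_ball_le x (by linarith)).trans ?_
      have : 4 * (R + r) + 3 ≤ 11 * R := by linarith
      calc (4 * (R + r) + 3) ^ 2 ≤ (11 * R) ^ 2 := by gcongr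
        _ = _ := by ring
    rw [nsmul_eq_mul]
    refine (mul_le_mul_of_nonneg_right e3 (by positivity)).trans (le_of_eq ?_)
    field_simp
    ring
  refine (sum_sq_sub_average_le _ f (A x)).trans ?_
  have hsplit : ∑ y ∈ h.finiteBalls.ball x R, (f y - A x) ^ 2 ≤
      2 * ∑ y ∈ h.finiteBalls.ball x R, (f y - A y) ^ 2 +
      2 * ∑ y ∈ h.finiteBalls.ball x R, (A y - A x) ^ 2 := by
    rw [Finset.mul_sum, Finset.mul_sum, ← Finset.sum_add_distrib]
    refine Finset.sum_le_sum fun y _ => ?_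
    nlinarith [sq_nonneg ((f y - A y) - (A y - A x))]
  have hpos : 0 ≤ (4 * (24 * (L : ℝ)) + 3) ^ 2 * R ^ 2 * E := by positivity
  calc _ ≤ _ := hsplit
    _ ≤ 2 * (1936 * Cv ^ 2 * Cw * R ^ 2 * E) + 2 * (49 * R ^ 2 * ((48 * L) ^ 2 * Ca * E)) := by
        linarith
    _ ≤ _ := by linarith

end GridApprox

/-! ### Rough isometry with the grid, and the conclusion -/

namespace PennyConfiguration

variable {V : Type*} [Infinite V] {P : PennyConfiguration V} {D : ℕ}

/-- A penny graph with faces of bounded degree is roughly isometric to the integer grid. -/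
theorem FaceBound.exists_gridApprox (hD : P.FaceBound D) (hconn : P.graph.Connected) :
    ∃ φ : ℤ × ℤ → V, GridApprox P.graph P.pos φ (50 * D + 2) ((D + 1) * (200 * D + 19) ^ 2) := by
  -- Any vertex around the grid point will do. The Lipschitz bounds all come from
  -- `FaceBound.dist_le_of_near`, since the points compared are at distance at most 2.
  choose φ hφ using fun i : ℤ × ℤ => P.around_nonempty hconn (gridPt i)
  refine ⟨φ, hconn, P.unitSeparated_pos, P.norm_pos_sub_le_dist hconn, ?_, ?_, ?_, ?_, ?_⟩
  · exact Nat.succ_le_of_lt (by positivity)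
  · intro i
    have := hD.norm_sub_le_of_mem_around hconn (hφ i)
    push_cast
    exact this
  · intro i
    refine hD.dist_le_of_near hconn ?_ (hφ i) (hφ _)
    have : gridPt i - gridPt (i.1 + 1, i.2) = -1 := by
      apply Complex.ext <;> simp [gridPt]
    rw [this]
    norm_num
  · intro i
    refine hD.dist_le_of_near hconn ?_ (hφ i) (hφ _)
    have : gridPt i - gridPt (i.1, i.2 + 1) = -Complex.I := by
      apply Complex.ext <;> simp [gridPt]
    rw [this]
    norm_num
  · intro v
    exact hD.dist_le_of_near hconn (norm_sub_gridFloor_le _) (P.mem_around_pos v) (hφ _)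

end PennyConfiguration

theorem theorem1p2 (D : ℕ) :
    ∃ C₁ C₂ : ℝ, 0 < C₁ ∧ 0 < C₂ ∧
      ∀ (V : Type*) [Infinite V] (P : PennyConfiguration V),
        P.graph.Connected →
        (∀ σ ∈ P.faces, P.facialDegree σ ≤ (D : ℕ∞)) →
        P.graph.VolumeDoublingWith C₁ ∧ P.graph.PoincareWith C₂ := by
  obtain ⟨C₂, hC₂, hP⟩ := GridApprox.exists_poincare (50 * D + 2) ((D + 1) * (200 * D + 19) ^ 2)
  refine ⟨64 * (18 * ((D + 1) * (200 * D + 19) ^ 2 : ℕ) ^ 2 * (4 * (50 * D + 2 : ℕ) + 3) ^ 2 + 2),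
    C₂, by positivity, hC₂, fun V _ P hconn hdeg => ?_⟩
  obtain ⟨φ, hφ⟩ := (P.faceBound_of_facialDegree_le hconn hdeg).exists_gridApprox hconn
  exact ⟨hφ.volumeDoublingWith, hP hφ⟩
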